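/- Let $F$ be a free group of finite rank with a chosen set of free generators, and let $T=(V,E)$ be the corresponding Cayley tree ($V=F$, an edge between $g$ and $gs$ for every $g\in F$ and every generator $s$; $E$ is the set of oriented edges, $\bar e$ the edge $e$ reversed). $F$ acts on $T$ by left multiplication, which embeds $F$ in the group $\mathrm{Aut}(T)$, endowed with the topology of pointwise convergence on $V$. A path is a non-empty sequence $p=(e_1,\dots,e_n)$ of successive oriented edges without backtracking; its length is $n$ and its reverse is $\bar p=(\bar e_n,\dots,\bar e_1)$. Let $\mathcal P$ be the space of finitely supported real functions $f$ on the set of paths with $f(\bar p)=-f(p)$, with the norm $\|f\|=\sum_{n\ge 1}\frac1{n!}\sum_{p \text{ of length } n}|f(p)|$, and let $\overline{\mathcal P}$ be its completion, an isometric Banach $\mathrm{Aut}(T)$-module. Let $\overline{\mathcal P}\,\widehat\otimes\,\overline{\mathcal P}$ be the completed projective tensor product. For $x_0,x_1\in V$ let $\theta(x_0,x_1)\in\mathcal P$ be the function with value $1$ at $p$ if $p$ is a sub-path of the path $[x_0,x_1]$, value $-1$ if $\bar p$ is, and $0$ otherwise, and let $\omega=d\theta\colon V^3\to\mathcal P$,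 $\omega(x_0,x_1,x_2)=\theta(x_1,x_2)-\theta(x_0,x_2)+\theta(x_0,x_1)$. For a vertex $v$, the class $[\omega]\in H^2_{cb}(\mathrm{Aut}(T),\overline{\mathcal P})$ in continuous bounded cohomology (computed by continuous bounded equivariant homogeneous cochains) is represented by the bounded cocycle $(g_0,g_1,g_2)\mapsto\omega(g_0v,g_1v,g_2v)$. For a reduced word $w$ in the generators, let $f_w(g)$ be the number of occurrences (overlaps allowed) of $w$ in the reduced word of $g\in F$ minus the number of its occurrences in that of $g^{-1}$, and let $\beta_w\in H^2_b(F,\mathbb R)$ be the class of the bounded cocycle $(g_0,g_1,g_2)\mapsto f_w(g_1^{-1}g_2)-f_w(g_0^{-1}g_2)+f_w(g_0^{-1}g_1)$. Every path $p$ is labelled by a reduced word; let $\lambda_w$ be the $F$-invariant bounded linear form on $\overline{\mathcal P}$ whose value on the element $\delta_p-\delta_{\bar p}$ of $\mathcal P$ is $1$ if $w$ labels $p$, $-1$ if $w$ labels $\bar p$, and $0$ otherwise, for every path $p$. Then, for all reduced words $w,w'$ and every vertex $v$, the class $[\omega]\cup[\omega]\in H^4_{cb}(\mathrm{Aut}(T),\overline{\mathcal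 P}\,\widehat\otimes\,\overline{\mathcal P})$ is mapped to $\beta_w\cup\beta_{w'}\in H^4_b(F,\mathbb R)$ under the restriction to $F$ followed by the map $(\lambda_w\otimes\lambda_{w'})_*$ induced by the bounded linear form $\lambda_w\otimes\lambda_{w'}$ on $\overline{\mathcal P}\,\widehat\otimes\,\overline{\mathcal P}$. -/

import Mathlib

noncomputable section

open scoped TensorProduct

set_option linter.unusedSectionVars false

namespace BCoh

/-! ### Continuous bounded cohomology -/

/-- The homogeneous coboundary: the alternating sum of the maps omitting one variable. -/
def cobd {X A : Type*} [AddCommGroup A] {n : ℕ} (f : (Fin (n + 1) → X) → A) :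
    (Fin (n + 2) → X) → A :=
  fun x => ∑ i : Fin (n + 2), (-1 : ℤ) ^ (i : ℕ) • f (fun j => x (i.succAbove j))

theorem cobd_cobd {X A : Type*} [AddCommGroup A] {n : ℕ} (f : (Fin (n + 1) → X) → A) :
    cobd (cobd f) = 0 := by
  funext x
  simp only [cobd, Finset.smul_sum, Pi.zero_apply, smul_smul, ← pow_add]
  rw [← Finset.univ.sum_product' Finset.univ (fun (i : Fin (n + 3)) (j : Fin (n + 2)) =>
    (-1 : ℤ) ^ ((i : ℕ) + (j : ℕ)) • f (fun k => x (i.succAbove (j.succAbove k))))]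
  refine Finset.sum_involution (fun p _ => (p.1.succAbove p.2, p.2.predAbove p.1)) ?_ ?_ ?_ ?_
  · rintro ⟨i, j⟩ -
    simp only [Fin.succAbove_succAbove_succAbove_predAbove, ← add_smul,
      Fin.neg_one_pow_succAbove_add_predAbove]
    simp
  · rintro ⟨i, j⟩ - - h
    exact Fin.succAbove_ne i j (congrArg Prod.fst h)
  · simp
  · rintro ⟨i, j⟩ -
    simp [Fin.succAbove_succAbove_predAbove, Fin.predAbove_predAbove_succAbove]

section Cohomology

variable {G E : Type*} [Group G] [TopologicalSpace G] [NormedAddCommGroup E] [NormedSpace ℝ E]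

/-- The homogeneous continuous bounded `n`-cochains of `G` with coefficients in the isometric
`G`-module `(E, ρ)`: bounded continuous `G`-equivariant maps `G ^ (n + 1) → E`. -/
def cochains (ρ : G →* (E ≃ₗᵢ[ℝ] E)) (n : ℕ) : Submodule ℝ ((Fin (n + 1) → G) → E) where
  carrier := {f | Continuous f ∧ (∃ C : ℝ, ∀ x, ‖f x‖ ≤ C) ∧
    ∀ g x, f (fun i => g * x i) = ρ g (f x)}
  add_mem' := by
    rintro f f' ⟨hc, ⟨C, hC⟩, he⟩ ⟨hc', ⟨C', hC'⟩, he'⟩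
    refine ⟨hc.add hc', ⟨C + C', fun x => norm_add_le_of_le (hC x) (hC' x)⟩, fun g x => ?_⟩
    simp [he g x, he' g x]
  zero_mem' := ⟨continuous_const, ⟨0, fun x => by simp⟩, fun g x => by simp⟩
  smul_mem' := by
    rintro c f ⟨hc, ⟨C, hC⟩, he⟩
    refine ⟨hc.const_smul c, ⟨‖c‖ * C, fun x => ?_⟩, fun g x => by simp [he g x]⟩
    rw [Pi.smul_apply, norm_smul]
    exact mul_le_mul_of_nonneg_left (hC x) (norm_nonneg c)

variable (ρ : G →* (E ≃ₗᵢ[ℝ] E))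

theorem cobd_mem_cochains {n : ℕ} {f : (Fin (n + 1) → G) → E} (hf : f ∈ cochains ρ n) :
    cobd f ∈ cochains ρ (n + 1) := by
  obtain ⟨hc, ⟨C, hC⟩, he⟩ := hf
  refine ⟨?_, ⟨(n + 2) * C, fun x => ?_⟩, fun g x => ?_⟩
  · refine continuous_finsetSum _ fun i _ => ?_
    have h : Continuous fun (x : Fin (n + 2) → G) (j : Fin (n + 1)) => x (i.succAbove j) :=
      continuous_pi fun j => continuous_apply (i.succAbove j)
    exact (hc.comp h).zsmul _
  · refine (norm_sum_le _ _).trans ?_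
    have : ∀ i ∈ (Finset.univ : Finset (Fin (n + 2))),
        ‖(-1 : ℤ) ^ (i : ℕ) • f (fun j => x (i.succAbove j))‖ ≤ C := by
      intro i _
      rcases neg_one_pow_eq_or ℤ (i : ℕ) with h | h <;> rw [h] <;> simpa using hC _
    refine (Finset.sum_le_card_nsmul _ _ _ this).trans ?_
    simp
  · simp only [cobd, he g, map_sum, map_zsmul]

/-- The coboundary as a linear map on all functions. -/
def cobdL (X A : Type*) [AddCommGroup A] [Module ℝ A] (n : ℕ) :
    ((Fin (n + 1) → X) → A) →ₗ[ℝ] ((Fin (n + 2) → X) → A) where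
  toFun := cobd
  map_add' f g := by ext x; simp [cobd, Finset.sum_add_distrib]
  map_smul' c f := by
    ext x
    simp only [cobd, Pi.smul_apply, RingHom.id_apply, Finset.smul_sum]
    exact Finset.sum_congr rfl fun i _ => smul_comm _ _ _

/-- Continuous bounded cocycles. -/
def cocycles (n : ℕ) : Submodule ℝ ((Fin (n + 1) → G) → E) :=
  cochains ρ n ⊓ LinearMap.ker (cobdL G E n)

/-- Coboundaries of continuous bounded cochains (only `0` in degree `0`). -/
def coboundaries : (n : ℕ) → Submodule ℝ ((Fin (n + 1) → G) → E)
  | 0 => ⊥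
  | n + 1 => (cochains ρ n).map (cobdL G E n)

theorem coboundaries_le_cocycles (n : ℕ) : coboundaries ρ n ≤ cocycles ρ n := by
  cases n with
  | zero => exact bot_le
  | succ n =>
    rintro _ ⟨f, hf, rfl⟩
    exact ⟨cobd_mem_cochains ρ hf, cobd_cobd f⟩

/-- The continuous bounded cohomology `H_cb^n(G, E)` of the topological group `G` with coefficients
in `(E, ρ)`; for a discrete group this is the bounded cohomology `H_b^n(G, E)`. -/
abbrev Hcb (n : ℕ) : Type _ := cocycles ρ n ⧸ (coboundaries ρ n).submoduleOf (cocycles ρ n)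

variable {ρ}

/-- The class of a cocycle. -/
def cls {n : ℕ} (f : (Fin (n + 1) → G) → E) (hf : f ∈ cocycles ρ n) : Hcb ρ n :=
  Submodule.Quotient.mk ⟨f, hf⟩

variable {K F : Type*} [Group K] [TopologicalSpace K] [NormedAddCommGroup F] [NormedSpace ℝ F]
  {σ : K →* (F ≃ₗᵢ[ℝ] F)}

/-- The map `f ↦ A ∘ f ∘ φ` on functions. -/
def mapFun (φ : K →* G) (A : E →L[ℝ] F) (n : ℕ) :
    ((Fin (n + 1) → G) → E) →ₗ[ℝ] ((Fin (n + 1) → K) → F) where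
  toFun f := fun x => A (f fun i => φ (x i))
  map_add' f g := by ext x; simp
  map_smul' c f := by ext x; simp

theorem mapFun_mem_cochains (φ : K →* G) (hφ : Continuous φ) (A : E →L[ℝ] F)
    (hA : ∀ k v, A (ρ (φ k) v) = σ k (A v)) (n : ℕ) {f : (Fin (n + 1) → G) → E}
    (hf : f ∈ cochains ρ n) : mapFun φ A n f ∈ cochains σ n := by
  obtain ⟨hc, ⟨C, hC⟩, he⟩ := hf
  refine ⟨?_, ⟨‖A‖ * C, fun x => A.le_opNorm_of_le (hC _)⟩, fun k x => ?_⟩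
  · exact A.continuous.comp (hc.comp (continuous_pi fun i => hφ.comp (continuous_apply i)))
  · simp only [mapFun, LinearMap.coe_mk, AddHom.coe_mk, map_mul]
    rw [he (φ k), hA]

theorem cobd_mapFun (φ : K →* G) (A : E →L[ℝ] F) (n : ℕ) (f : (Fin (n + 1) → G) → E) :
    cobd (mapFun φ A n f) = mapFun φ A (n + 1) (cobd f) := by
  ext x; simp [mapFun, cobd, map_sum, map_zsmul]

/-- The map `f ↦ A ∘ f ∘ φ` induced in cohomology by a continuous homomorphism `φ : K → G` and a
bounded `K`-equivariant linear map `A : E → F` of coefficients. -/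
def mapH (φ : K →* G) (hφ : Continuous φ) (A : E →L[ℝ] F)
    (hA : ∀ k v, A (ρ (φ k) v) = σ k (A v)) (n : ℕ) : Hcb ρ n →ₗ[ℝ] Hcb σ n :=
  Submodule.mapQ _ _
    ((mapFun φ A n).restrict (p := cocycles ρ n) (q := cocycles σ n) (by
      rintro f ⟨hf, hf'⟩
      refine ⟨mapFun_mem_cochains φ hφ A hA n hf, ?_⟩
      have h0 : cobd f = 0 := hf'
      change cobd (mapFun φ A n f) = 0
      rw [cobd_mapFun, h0, map_zero])) (by
    rintro ⟨f, hf⟩ h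
    cases n with
    | zero =>
      have h0 : f = 0 := h
      subst h0
      exact Submodule.zero_mem (Submodule.comap _ _)
    | succ n =>
      obtain ⟨e, he, rfl⟩ := (h : f ∈ (cochains ρ n).map (cobdL G E n))
      exact ⟨mapFun φ A n e, mapFun_mem_cochains φ hφ A hA n he, cobd_mapFun φ A n e⟩)

/-- The restriction map `H_cb^n(G, E) → H_cb^n(K, E)` along a continuous homomorphism `K → G`. -/
def res (ρ : G →* (E ≃ₗᵢ[ℝ] E)) (φ : K →* G) (hφ : Continuous φ) (n : ℕ) :
    Hcb ρ n →ₗ[ℝ] Hcb (ρ.comp φ) n :=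
  mapH φ hφ (ContinuousLinearMap.id ℝ E) (fun _ _ => rfl) n

/-- The map `A_* : H_cb^n(K, E) → H_cb^n(K, F)` induced by a bounded equivariant linear map. -/
def coeff {κ : K →* (E ≃ₗᵢ[ℝ] E)} (A : E →L[ℝ] F) (hA : ∀ k v, A (κ k v) = σ k (A v)) (n : ℕ) :
    Hcb κ n →ₗ[ℝ] Hcb σ n :=
  mapH (MonoidHom.id K) continuous_id A hA n

end Cohomology

section Cup

variable {G E F H : Type*} [Group G] [TopologicalSpace G] [NormedAddCommGroup E] [NormedSpace ℝ E]
  [NormedAddCommGroup F] [NormedSpace ℝ F] [NormedAddCommGroup H] [NormedSpace ℝ H]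

/-- The cup product of homogeneous cochains relative to a bounded bilinear pairing `B`:
`(f ∪ g)(x₀, …, x_{p+q}) = B (f (x₀, …, x_p)) (g (x_p, …, x_{p+q}))`. -/
def cupFun {X : Type*} (B : E →L[ℝ] F →L[ℝ] H) {p q : ℕ} (f : (Fin (p + 1) → X) → E)
    (g : (Fin (q + 1) → X) → F) : (Fin (p + q + 1) → X) → H :=
  fun x => B (f fun i => x ⟨i, by omega⟩) (g fun j => x ⟨p + j, by omega⟩)

/-- The Leibniz rule. -/
theorem cobd_cupFun {X : Type*} (B : E →L[ℝ] F →L[ℝ] H) {p q : ℕ} (f : (Fin (p + 1) → X) → E)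
    (g : (Fin (q + 1) → X) → F) (x : Fin (p + q + 2) → X) :
    cobd (cupFun B f g) x =
      cupFun B (cobd f) g (fun i : Fin (p + 1 + q + 1) => x ⟨i, by omega⟩) +
        (-1 : ℤ) ^ p • cupFun B f (cobd g) x := by
  have hN : (p + 1) + (q + 1) = p + q + 2 := by omega
  have e1 : ∀ i : Fin (p + 1),
      cupFun B f g (fun j => x ((Fin.cast hN (Fin.castAdd (q + 1) i)).succAbove j)) =
      B (f fun j => x ⟨i.castSucc.succAbove j, by omega⟩)
        (g fun j => x ⟨p + 1 + j, by omega⟩) := by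
    intro i
    refine congrArg₂ (fun a b => B a b) (congrArg f (funext fun j => congrArg x (Fin.ext ?_)))
      (congrArg g (funext fun j => congrArg x (Fin.ext ?_)))
    · simp only [Fin.succAbove, Fin.lt_def, Fin.val_cast, Fin.val_castAdd, Fin.val_castSucc]
      split_ifs <;> simp
    · have : ¬ (p + (j : ℕ) < i) := by omega
      simp only [Fin.succAbove, Fin.lt_def, Fin.val_cast, Fin.val_castAdd, Fin.val_castSucc, this]
      simp
      omega
  have e2 : ∀ i : Fin (q + 1),
      cupFun B f g (fun j => x ((Fin.cast hN (Fin.natAdd (p + 1) i)).succAbove j)) =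
      B (f fun j => x ⟨j, by omega⟩)
        (g fun j => x ⟨p + i.succ.succAbove j, by omega⟩) := by
    intro i
    refine congrArg₂ (fun a b => B a b) (congrArg f (funext fun j => congrArg x (Fin.ext ?_)))
      (congrArg g (funext fun j => congrArg x (Fin.ext ?_)))
    · have : ((j : ℕ) < p + 1 + i) := by omega
      simp only [Fin.succAbove, Fin.lt_def, Fin.val_cast, Fin.val_natAdd, Fin.val_castSucc, this]
      simp
    · have : (p + (j : ℕ) < p + 1 + i) ↔ (j : ℕ) < i + 1 := by omega
      simp only [Fin.succAbove, Fin.lt_def, Fin.val_cast, Fin.val_natAdd, Fin.val_castSucc, this,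
        Fin.val_succ]
      split_ifs <;> simp
      omega
  have h1 : cobd (cupFun B f g) x = (∑ i : Fin (p + 1), (-1 : ℤ) ^ (i : ℕ) •
        B (f fun j => x ⟨i.castSucc.succAbove j, by omega⟩) (g fun j => x ⟨p + 1 + j, by omega⟩))
      + ∑ i : Fin (q + 1), (-1 : ℤ) ^ (p + 1 + i : ℕ) •
        B (f fun j => x ⟨j, by omega⟩) (g fun j => x ⟨p + i.succ.succAbove j, by omega⟩) := by
    rw [cobd, ← Equiv.sum_comp (finCongr hN), Fin.sum_univ_add]
    simp only [finCongr_apply, e1, e2]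
    simp
  have h2 : cupFun B (cobd f) g (fun i : Fin (p + 1 + q + 1) => x ⟨i, by omega⟩) =
      (∑ i : Fin (p + 1), (-1 : ℤ) ^ (i : ℕ) •
        B (f fun j => x ⟨i.castSucc.succAbove j, by omega⟩) (g fun j => x ⟨p + 1 + j, by omega⟩))
      + (-1 : ℤ) ^ (p + 1) • B (f fun j => x ⟨j, by omega⟩) (g fun j => x ⟨p + 1 + j, by omega⟩) := by
    unfold cupFun cobd
    rw [Fin.sum_univ_castSucc]
    simp [map_sum, map_zsmul]
  have h3 : cupFun B f (cobd g) x =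
      B (f fun j => x ⟨j, by omega⟩) (g fun j => x ⟨p + 1 + j, by omega⟩)
      + ∑ i : Fin (q + 1), (-1 : ℤ) ^ (i + 1 : ℕ) •
        B (f fun j => x ⟨j, by omega⟩) (g fun j => x ⟨p + i.succ.succAbove j, by omega⟩) := by
    unfold cupFun cobd
    rw [Fin.sum_univ_succ]
    rw [map_add, map_sum]
    simp only [map_zsmul, Fin.val_zero, pow_zero, one_smul, Fin.val_succ]
    refine congrArg₂ _ ?_ rfl
    refine congrArg _ (congrArg g (funext fun j => congrArg x (Fin.ext ?_)))
    simp
    omega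
  rw [h1, h2, h3, smul_add, Finset.smul_sum, pow_succ (-1 : ℤ) p]
  simp only [smul_smul, ← pow_add]
  have : ∀ i : ℕ, p + 1 + i = p + (i + 1) := by intro i; omega
  simp only [this]
  simp

variable {ρ : G →* (E ≃ₗᵢ[ℝ] E)} {σ : G →* (F ≃ₗᵢ[ℝ] F)} {τ : G →* (H ≃ₗᵢ[ℝ] H)}

theorem cupFun_mem_cochains (B : E →L[ℝ] F →L[ℝ] H)
    (hB : ∀ g u v, B (ρ g u) (σ g v) = τ g (B u v)) {p q : ℕ} {f : (Fin (p + 1) → G) → E}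
    {g : (Fin (q + 1) → G) → F} (hf : f ∈ cochains ρ p) (hg : g ∈ cochains σ q) :
    cupFun B f g ∈ cochains τ (p + q) := by
  obtain ⟨hc, ⟨C, hC⟩, he⟩ := hf
  obtain ⟨hc', ⟨C', hC'⟩, he'⟩ := hg
  refine ⟨?_, ⟨‖B‖ * C * C', fun x => B.le_of_opNorm₂_le_of_le le_rfl (hC _) (hC' _)⟩, fun k x => ?_⟩
  · refine Continuous.clm_apply (B.continuous.comp (hc.comp ?_)) (hc'.comp ?_) <;>
    exact continuous_pi fun i => continuous_apply _
  · simp only [cupFun]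
    rw [he k (fun i => x ⟨i, _⟩), he' k (fun i => x ⟨p + i, _⟩), hB]

theorem cupFun_mem_cocycles (B : E →L[ℝ] F →L[ℝ] H)
    (hB : ∀ g u v, B (ρ g u) (σ g v) = τ g (B u v)) {p q : ℕ} {f : (Fin (p + 1) → G) → E}
    {g : (Fin (q + 1) → G) → F} (hf : f ∈ cocycles ρ p) (hg : g ∈ cocycles σ q) :
    cupFun B f g ∈ cocycles τ (p + q) := by
  refine ⟨cupFun_mem_cochains B hB hf.1 hg.1, ?_⟩
  have h1 : cobd f = 0 := hf.2
  have h2 : cobd g = 0 := hg.2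
  change cobd (cupFun B f g) = 0
  funext x
  rw [cobd_cupFun, h1, h2]
  simp [cupFun]

theorem mem_coboundaries_of_eq {n m : ℕ} (h : m + 1 = n) {f : (Fin (n + 1) → G) → E}
    {e : (Fin (m + 1) → G) → E} (he : e ∈ cochains ρ m)
    (hfe : ∀ x : Fin (m + 2) → G, cobd e x = f (fun i => x ⟨i, by omega⟩)) :
    f ∈ coboundaries ρ n := by
  subst h
  exact ⟨e, he, funext hfe⟩

theorem cupFun_mem_coboundaries_left (B : E →L[ℝ] F →L[ℝ] H)
    (hB : ∀ g u v, B (ρ g u) (σ g v) = τ g (B u v)) {p q : ℕ} {f : (Fin (p + 1) → G) → E}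
    {g : (Fin (q + 1) → G) → F} (hf : f ∈ coboundaries ρ p) (hg : g ∈ cocycles σ q) :
    cupFun B f g ∈ coboundaries τ (p + q) := by
  cases p with
  | zero =>
    have h0 : f = 0 := hf
    have : cupFun B f g = 0 := by funext x; simp [h0, cupFun]
    rw [this]; exact zero_mem _
  | succ p =>
    obtain ⟨e, he, rfl⟩ := hf
    refine mem_coboundaries_of_eq (m := p + q) (by omega) (cupFun_mem_cochains B hB he hg.1) ?_
    intro x
    have h2 : cobd g = 0 := hg.2
    rw [cobd_cupFun, h2]
    have : cupFun B e (0 : (Fin (q + 2) → G) → F) x = 0 := by simp [cupFun]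
    rw [this, smul_zero, add_zero]
    rfl

theorem cupFun_mem_coboundaries_right (B : E →L[ℝ] F →L[ℝ] H)
    (hB : ∀ g u v, B (ρ g u) (σ g v) = τ g (B u v)) {p q : ℕ} {f : (Fin (p + 1) → G) → E}
    {g : (Fin (q + 1) → G) → F} (hf : f ∈ cocycles ρ p) (hg : g ∈ coboundaries σ q) :
    cupFun B f g ∈ coboundaries τ (p + q) := by
  cases q with
  | zero =>
    have h0 : g = 0 := hg
    have : cupFun B f g = 0 := by funext x; simp [h0, cupFun]
    rw [this]; exact zero_mem _
  | succ q =>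
    obtain ⟨e, he, rfl⟩ := hg
    have he' := (cochains σ q).smul_mem ((-1 : ℝ) ^ p) he
    refine mem_coboundaries_of_eq (m := p + q) (by omega) (cupFun_mem_cochains B hB hf.1 he') ?_
    intro x
    have h2 : cobd f = 0 := hf.2
    have h3 : cobd ((-1 : ℝ) ^ p • e) = (-1 : ℝ) ^ p • cobd e := (cobdL G F q).map_smul _ _
    rw [cobd_cupFun, h2, h3]
    have : ∀ y, cupFun B (0 : (Fin (p + 2) → G) → E) ((-1 : ℝ) ^ p • e) y = 0 := by
      intro y; simp [cupFun]
    rw [this, zero_add]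
    simp only [cupFun, Pi.smul_apply, map_smul]
    rcases Nat.even_or_odd p with h | h <;> simp [h.neg_one_pow, cobdL]

/-- The cup product of cocycles. -/
def cupZ (B : E →L[ℝ] F →L[ℝ] H) (hB : ∀ g u v, B (ρ g u) (σ g v) = τ g (B u v)) (p q : ℕ) :
    cocycles ρ p →ₗ[ℝ] cocycles σ q →ₗ[ℝ] cocycles τ (p + q) :=
  LinearMap.mk₂ ℝ (fun f g => ⟨cupFun B f.1 g.1, cupFun_mem_cocycles B hB f.2 g.2⟩)
    (fun f f' g => Subtype.ext (by funext x; simp [cupFun]))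
    (fun a f g => Subtype.ext (by funext x; simp [cupFun]))
    (fun f g g' => Subtype.ext (by funext x; simp [cupFun]))
    (fun a f g => Subtype.ext (by funext x; simp [cupFun]))

/-- The cup product `H_cb^p(G, E) × H_cb^q(G, F) → H_cb^{p+q}(G, H)` relative to a bounded
`G`-equivariant bilinear pairing `B : E × F → H`. -/
def cup (B : E →L[ℝ] F →L[ℝ] H) (hB : ∀ g u v, B (ρ g u) (σ g v) = τ g (B u v)) (p q : ℕ) :
    Hcb ρ p →ₗ[ℝ] Hcb σ q →ₗ[ℝ] Hcb τ (p + q) :=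
  let c : cocycles ρ p →ₗ[ℝ] cocycles σ q →ₗ[ℝ] Hcb τ (p + q) :=
    (cupZ B hB p q).compr₂ (Submodule.mkQ _)
  let c₁ : Hcb ρ p →ₗ[ℝ] cocycles σ q →ₗ[ℝ] Hcb τ (p + q) :=
    Submodule.liftQ _ c (fun f hf => LinearMap.mem_ker.2 <| LinearMap.ext fun g =>
      (Submodule.Quotient.mk_eq_zero _).2 (cupFun_mem_coboundaries_left B hB hf g.2))
  LinearMap.flip <| Submodule.liftQ _ c₁.flip (fun g hg => LinearMap.mem_ker.2 <| by
    ext f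
    exact (Submodule.Quotient.mk_eq_zero _).2 (cupFun_mem_coboundaries_right B hB f.2 hg))

theorem cup_cls (B : E →L[ℝ] F →L[ℝ] H) (hB : ∀ g u v, B (ρ g u) (σ g v) = τ g (B u v)) (p q : ℕ)
    (f : (Fin (p + 1) → G) → E) (g : (Fin (q + 1) → G) → F) (hf : f ∈ cocycles ρ p)
    (hg : g ∈ cocycles σ q) :
    cup B hB p q (cls f hf) (cls g hg) = cls (cupFun B f g) (cupFun_mem_cocycles B hB hf hg) :=
  rfl

end Cup

section Projective

open UniformSpace

theorem completion_comp_eq {E : Type*} [SeminormedAddCommGroup E] [NormedSpace ℝ E]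
    (f g h : E →L[ℝ] E) (hfg : ∀ a, f (g a) = h a) (x : Completion E) :
    f.completion (g.completion x) = h.completion x := by
  refine Completion.induction_on x (isClosed_eq ?_ h.completion.continuous) fun a => ?_
  · exact f.completion.continuous.comp g.completion.continuous
  · simp [hfg]

theorem completion_id_eq {E : Type*} [SeminormedAddCommGroup E] [NormedSpace ℝ E]
    (h : E →L[ℝ] E) (hh : ∀ a, h a = a) (x : Completion E) : h.completion x = x := by
  refine Completion.induction_on x (isClosed_eq h.completion.continuous continuous_id) fun a => ?_
  simp [hh]

/-- The unique extension of an isometric linear representation to the completion. -/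
def completionRep {G E : Type*} [Group G] [SeminormedAddCommGroup E] [NormedSpace ℝ E]
    (ρ : G →* (E ≃ₗᵢ[ℝ] E)) : G →* (Completion E ≃ₗᵢ[ℝ] Completion E) where
  toFun g :=
    { toLinearEquiv :=
        { ((ρ g : E →L[ℝ] E).completion : Completion E →ₗ[ℝ] Completion E) with
          invFun := ((ρ g).symm : E →L[ℝ] E).completion
          left_inv := fun x =>
            (completion_comp_eq _ _ (ContinuousLinearMap.id ℝ E) (fun a => by simp) x).trans
              (completion_id_eq _ (fun _ => rfl) x)
          right_inv := fun x =>
            (completion_comp_eq _ _ (ContinuousLinearMap.id ℝ E) (fun a => by simp) x).trans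
              (completion_id_eq _ (fun _ => rfl) x) }
      norm_map' := fun x => by
        change ‖(ρ g : E →L[ℝ] E).completion x‖ = ‖x‖
        refine Completion.induction_on x (isClosed_eq ?_ continuous_norm) fun a => ?_
        · exact continuous_norm.comp (ContinuousLinearMap.continuous _)
        · simp }
  map_one' := LinearIsometryEquiv.ext fun x => completion_id_eq _ (fun a => by simp) x
  map_mul' g h := LinearIsometryEquiv.ext fun x =>
    (completion_comp_eq (ρ g : E →L[ℝ] E) (ρ h : E →L[ℝ] E) _ (fun a => by simp) x).symm

@[simp] theorem completionRep_coe {G E : Type*} [Group G] [SeminormedAddCommGroup E]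
    [NormedSpace ℝ E] (ρ : G →* (E ≃ₗᵢ[ℝ] E)) (g : G) (a : E) :
    completionRep ρ g (a : Completion E) = (ρ g a : E) :=
  ContinuousLinearMap.completion_apply_coe _ a

variable (E F : Type*) [NormedAddCommGroup E] [NormedSpace ℝ E] [NormedAddCommGroup F]
  [NormedSpace ℝ F]

/-- The algebraic tensor product `E ⊗ F`, to be endowed with the projective cross-norm. -/
def ProjTensor : Type _ := E ⊗[ℝ] F

instance : AddCommGroup (ProjTensor E F) := inferInstanceAs (AddCommGroup (E ⊗[ℝ] F))

instance : Module ℝ (ProjTensor E F) := inferInstanceAs (Module ℝ (E ⊗[ℝ] F))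

variable {E F}

/-- The elementary tensors. -/
def ptmul (u : E) (v : F) : ProjTensor E F := (u ⊗ₜ[ℝ] v : E ⊗[ℝ] F)

/-- The set of all numbers `∑ ‖uᵢ‖ ‖vᵢ‖` over the finite expressions `t = ∑ uᵢ ⊗ vᵢ`. -/
def projCosts (t : ProjTensor E F) : Set ℝ :=
  {r | ∃ l : List (E × F), (l.map fun a => ptmul a.1 a.2).sum = t ∧
    (l.map fun a => ‖a.1‖ * ‖a.2‖).sum = r}

/-- The projective cross-norm `‖t‖_π = inf {∑ ‖uᵢ‖ ‖vᵢ‖ : t = ∑ uᵢ ⊗ vᵢ}`. -/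
def projNorm (t : ProjTensor E F) : ℝ := sInf (projCosts t)

theorem projCosts_nonempty (t : ProjTensor E F) : (projCosts t).Nonempty := by
  suffices ∃ l : List (E × F), (l.map fun a => ptmul a.1 a.2).sum = t by
    obtain ⟨l, hl⟩ := this
    exact ⟨_, l, hl, rfl⟩
  refine TensorProduct.induction_on (motive := fun t : E ⊗[ℝ] F =>
    ∃ l : List (E × F), (l.map fun a => ptmul a.1 a.2).sum = t) t ⟨[], rfl⟩ ?_ ?_
  · intro u v
    exact ⟨[(u, v)], by simp; rfl⟩
  · rintro _ _ ⟨l, rfl⟩ ⟨l', rfl⟩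
    exact ⟨l ++ l', by simp; rfl⟩

theorem projCosts_nonneg {t : ProjTensor E F} {r : ℝ} (hr : r ∈ projCosts t) : 0 ≤ r := by
  obtain ⟨l, -, rfl⟩ := hr
  refine List.sum_nonneg fun a ha => ?_
  obtain ⟨b, -, rfl⟩ := List.mem_map.1 ha
  positivity

theorem projNorm_le {t : ProjTensor E F} {r : ℝ} (hr : r ∈ projCosts t) : projNorm t ≤ r :=
  csInf_le ⟨0, fun _ h => projCosts_nonneg h⟩ hr

theorem projNorm_smul_le (c : ℝ) (t : ProjTensor E F) : projNorm (c • t) ≤ ‖c‖ * projNorm t := by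
  have : projNorm t = sInf (projCosts t) := rfl
  rw [this, ← smul_eq_mul, ← Real.sInf_smul_of_nonneg (norm_nonneg c)]
  refine le_csInf ((projCosts_nonempty t).smul_set) ?_
  rintro _ ⟨_, ⟨l, rfl, rfl⟩, rfl⟩
  refine projNorm_le ⟨l.map fun a => (c • a.1, a.2), ?_, ?_⟩
  · rw [List.smul_sum, List.map_map, List.map_map]
    exact congrArg List.sum (List.map_congr_left fun a _ => rfl)
  · simp only [smul_eq_mul, List.map_map, ← List.sum_map_mul_left]
    refine congrArg List.sum (List.map_congr_left fun a _ => ?_)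
    simp [norm_smul, mul_assoc]

instance : SeminormedAddCommGroup (ProjTensor E F) :=
  AddGroupSeminorm.toSeminormedAddCommGroup
    { toFun := projNorm
      map_zero' := le_antisymm (projNorm_le ⟨[], rfl, rfl⟩)
        (le_csInf (projCosts_nonempty _) fun _ h => projCosts_nonneg h)
      add_le' := fun s t => by
        have hs : BddBelow (projCosts s) := ⟨0, fun _ h => projCosts_nonneg h⟩
        have ht : BddBelow (projCosts t) := ⟨0, fun _ h => projCosts_nonneg h⟩
        change projNorm (s + t) ≤ sInf (projCosts s) + sInf (projCosts t)
        rw [← csInf_add (projCosts_nonempty s) hs (projCosts_nonempty t) ht]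
        refine le_csInf ((projCosts_nonempty s).add (projCosts_nonempty t)) ?_
        rintro _ ⟨_, ⟨l, rfl, rfl⟩, _, ⟨l', rfl, rfl⟩, rfl⟩
        exact projNorm_le ⟨l ++ l', by simp, by simp⟩
      neg' := fun t => by
        have h : ∀ t : ProjTensor E F, projNorm (-t) ≤ projNorm t := fun t => by
          have := projNorm_smul_le (-1) t
          simpa using this
        exact le_antisymm (h t) (by simpa using h (-t)) }

theorem projTensor_norm_def (t : ProjTensor E F) : ‖t‖ = projNorm t := rfl

instance : NormedSpace ℝ (ProjTensor E F) where
  norm_smul_le := projNorm_smul_le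

/-- The bounded linear map on `E ⊗ F` given by a bounded bilinear map on `E × F`. -/
def projLift₀ {H : Type*} [SeminormedAddCommGroup H] [NormedSpace ℝ H] (B : E →ₗ[ℝ] F →ₗ[ℝ] H)
    (C : ℝ) (hB : ∀ u v, ‖B u v‖ ≤ C * (‖u‖ * ‖v‖)) : ProjTensor E F →L[ℝ] H :=
  LinearMap.mkContinuous (TensorProduct.lift B : E ⊗[ℝ] F →ₗ[ℝ] H) (max C 0) (by
    intro t
    change ‖TensorProduct.lift B t‖ ≤ max C 0 * sInf (projCosts t)
    rw [← smul_eq_mul, ← Real.sInf_smul_of_nonneg (le_max_right C 0)]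
    refine le_csInf ((projCosts_nonempty t).smul_set) ?_
    rintro _ ⟨_, ⟨l, rfl, rfl⟩, rfl⟩
    simp only [smul_eq_mul]
    induction l with
    | nil =>
      have : TensorProduct.lift B (0 : E ⊗[ℝ] F) = 0 := map_zero _
      refine (congrArg norm this).le.trans ?_
      simp
    | cons a l ih =>
      have h1 : TensorProduct.lift B (((a :: l).map fun a => ptmul a.1 a.2).sum : ProjTensor E F) =
          B a.1 a.2 + TensorProduct.lift B ((l.map fun a => ptmul a.1 a.2).sum : ProjTensor E F) := by
        rw [List.map_cons, List.sum_cons]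
        exact (map_add _ _ _).trans (congrArg (· + _) (TensorProduct.lift.tmul _ _))
      rw [h1, List.map_cons, List.sum_cons, mul_add]
      refine norm_add_le_of_le ((hB _ _).trans ?_) ih
      exact mul_le_mul_of_nonneg_right (le_max_left _ _) (by positivity))

theorem projLift₀_ptmul {H : Type*} [SeminormedAddCommGroup H] [NormedSpace ℝ H]
    (B : E →ₗ[ℝ] F →ₗ[ℝ] H) (C : ℝ) (hB : ∀ u v, ‖B u v‖ ≤ C * (‖u‖ * ‖v‖)) (u : E) (v : F) :
    projLift₀ B C hB (ptmul u v) = B u v :=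
  TensorProduct.lift.tmul u v

variable (E F) in
/-- The completed projective tensor product `E ⊗̂ F`. -/
abbrev ProjCompl : Type _ := Completion (ProjTensor E F)

theorem norm_ptmul_le (u : E) (v : F) : ‖ptmul u v‖ ≤ ‖u‖ * ‖v‖ :=
  projNorm_le ⟨[(u, v)], by simp, by simp⟩

variable (E F) in
/-- The canonical bounded bilinear map `E × F → E ⊗̂ F`. -/
def tensorMk : E →L[ℝ] F →L[ℝ] ProjCompl E F :=
  LinearMap.mkContinuous₂
    (LinearMap.mk₂ ℝ (fun u v => ((ptmul u v : ProjTensor E F) : ProjCompl E F))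
      (fun u u' v => by
        rw [← Completion.coe_add]; exact congrArg _ (TensorProduct.add_tmul u u' v))
      (fun c u v => by
        rw [← Completion.coe_smul]; exact congrArg _ (TensorProduct.smul_tmul' c u v).symm)
      (fun u v v' => by
        rw [← Completion.coe_add]; exact congrArg _ (TensorProduct.tmul_add u v v'))
      (fun c u v => by
        rw [← Completion.coe_smul]; exact congrArg _ (TensorProduct.tmul_smul c u v)))
    1 (fun u v => by
      simpa using norm_ptmul_le u v)

theorem tensorMk_apply (u : E) (v : F) : tensorMk E F u v = (ptmul u v : ProjTensor E F) := rfl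

/-- The tensor product `A ⊗ A' : E ⊗̂ F → ℝ` of two bounded linear forms, the bounded linear form
with `(A ⊗ A') (u ⊗ v) = A u * A' v`. -/
def tensorForm (A : E →L[ℝ] ℝ) (A' : F →L[ℝ] ℝ) : ProjCompl E F →L[ℝ] ℝ :=
  (projLift₀ (LinearMap.mk₂ ℝ (fun u v => A u * A' v) (by intros; simp [add_mul])
    (by intros; simp [mul_assoc]) (by intros; simp [mul_add]) (by intros; simp; ring))
    (‖A‖ * ‖A'‖) (fun u v => by
      have := mul_le_mul (A.le_opNorm u) (A'.le_opNorm v) (norm_nonneg _) (by positivity)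
      simp only [LinearMap.mk₂_apply, norm_mul]
      linarith)).fromCompletion

theorem tensorForm_tensorMk (A : E →L[ℝ] ℝ) (A' : F →L[ℝ] ℝ) (u : E) (v : F) :
    tensorForm A A' (tensorMk E F u v) = A u * A' v := by
  rw [tensorMk_apply, tensorForm, ContinuousLinearMap.fromCompletion_apply_coe, projLift₀_ptmul]
  rfl

variable {G : Type*} [Group G]

theorem projNorm_congr_le (A : E ≃ₗᵢ[ℝ] E) (A' : F ≃ₗᵢ[ℝ] F) (t : ProjTensor E F) :
    projNorm (TensorProduct.congr A.toLinearEquiv A'.toLinearEquiv t : E ⊗[ℝ] F) ≤ projNorm t := by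
  refine le_csInf (projCosts_nonempty t) ?_
  rintro _ ⟨l, rfl, rfl⟩
  refine projNorm_le ⟨l.map fun a => (A a.1, A' a.2), ?_, ?_⟩
  · refine Eq.trans ?_ (map_list_sum (TensorProduct.congr A.toLinearEquiv A'.toLinearEquiv)
      (l.map fun a => a.1 ⊗ₜ[ℝ] a.2)).symm
    rw [List.map_map, List.map_map]
    refine congrArg List.sum (List.map_congr_left fun a _ => ?_)
    exact (TensorProduct.congr_tmul A.toLinearEquiv A'.toLinearEquiv a.1 a.2).symm
  · rw [List.map_map]
    refine congrArg List.sum (List.map_congr_left fun a _ => ?_)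
    simp

/-- The tensor product of two isometric representations, on the algebraic tensor product. -/
def tensorRep₀ (ρ : G →* (E ≃ₗᵢ[ℝ] E)) (σ : G →* (F ≃ₗᵢ[ℝ] F)) :
    G →* (ProjTensor E F ≃ₗᵢ[ℝ] ProjTensor E F) where
  toFun g :=
    { toLinearEquiv :=
        (TensorProduct.congr (ρ g).toLinearEquiv (σ g).toLinearEquiv : E ⊗[ℝ] F ≃ₗ[ℝ] E ⊗[ℝ] F)
      norm_map' := fun t => by
        refine le_antisymm (projNorm_congr_le (ρ g) (σ g) t) ?_
        have h := projNorm_congr_le (ρ g).symm (σ g).symm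
          (TensorProduct.congr (ρ g).toLinearEquiv (σ g).toLinearEquiv t : E ⊗[ℝ] F)
        have h' : (TensorProduct.congr (ρ g).symm.toLinearEquiv (σ g).symm.toLinearEquiv
          (TensorProduct.congr (ρ g).toLinearEquiv (σ g).toLinearEquiv t : E ⊗[ℝ] F)) = t :=
          (TensorProduct.congr (ρ g).toLinearEquiv (σ g).toLinearEquiv).symm_apply_apply t
        rw [h'] at h
        exact h }
  map_one' := LinearIsometryEquiv.ext fun t => by
    rw [map_one, map_one]
    exact LinearMap.congr_fun (TensorProduct.map_id (R := ℝ) (M := E) (N := F)) t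
  map_mul' g h := LinearIsometryEquiv.ext fun t => by
    rw [map_mul, map_mul]
    exact LinearMap.congr_fun (TensorProduct.map_comp ((ρ g).toLinearEquiv : E →ₗ[ℝ] E)
      ((σ g).toLinearEquiv : F →ₗ[ℝ] F) ((ρ h).toLinearEquiv : E →ₗ[ℝ] E)
      ((σ h).toLinearEquiv : F →ₗ[ℝ] F)) t

/-- The tensor product representation on `E ⊗̂ F`. -/
def tensorRep (ρ : G →* (E ≃ₗᵢ[ℝ] E)) (σ : G →* (F ≃ₗᵢ[ℝ] F)) :
    G →* (ProjCompl E F ≃ₗᵢ[ℝ] ProjCompl E F) :=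
  completionRep (tensorRep₀ ρ σ)

theorem tensorMk_equivariant (ρ : G →* (E ≃ₗᵢ[ℝ] E)) (σ : G →* (F ≃ₗᵢ[ℝ] F)) (g : G) (u : E)
    (v : F) : tensorMk E F (ρ g u) (σ g v) = tensorRep ρ σ g (tensorMk E F u v) := by
  rw [tensorMk_apply, tensorMk_apply, tensorRep, completionRep_coe]
  rfl

theorem tensorForm_invariant (ρ : G →* (E ≃ₗᵢ[ℝ] E)) (σ : G →* (F ≃ₗᵢ[ℝ] F)) (A : E →L[ℝ] ℝ)
    (A' : F →L[ℝ] ℝ) (g : G) (hA : ∀ u, A (ρ g u) = A u) (hA' : ∀ v, A' (σ g v) = A' v)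
    (t : ProjCompl E F) : tensorForm A A' (tensorRep ρ σ g t) = tensorForm A A' t := by
  refine Completion.induction_on t (isClosed_eq ?_ (tensorForm A A').continuous) fun s => ?_
  · exact (tensorForm A A').continuous.comp (tensorRep ρ σ g).continuous
  · let L : ProjTensor E F →ₗ[ℝ] ℝ := (tensorForm A A' ∘L
      ((tensorRep ρ σ g).toContinuousLinearEquiv : ProjCompl E F →L[ℝ] ProjCompl E F) ∘L
      (Completion.toComplL : ProjTensor E F →L[ℝ] ProjCompl E F) : ProjTensor E F →L[ℝ] ℝ)
    let L' : ProjTensor E F →ₗ[ℝ] ℝ := (tensorForm A A' ∘L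
      (Completion.toComplL : ProjTensor E F →L[ℝ] ProjCompl E F) : ProjTensor E F →L[ℝ] ℝ)
    have h : (L : E ⊗[ℝ] F →ₗ[ℝ] ℝ) = L' := by
      refine TensorProduct.ext' fun u v => ?_
      change tensorForm A A' (tensorRep ρ σ g (tensorMk E F u v)) =
        tensorForm A A' (tensorMk E F u v)
      rw [← tensorMk_equivariant, tensorForm_tensorMk, tensorForm_tensorMk, hA, hA']
    exact LinearMap.congr_fun h s

end Projective

section Tree

open UniformSpace

variable {V : Type*} {T : SimpleGraph V}

/-- The reverse of a sequence of oriented edges: `(e₁, …, eₙ) ↦ (ēₙ, …, ē₁)`. -/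
def revList (l : List T.Dart) : List T.Dart := (l.map SimpleGraph.Dart.symm).reverse

theorem revList_revList (l : List T.Dart) : revList (revList l) = l := by
  simp [revList, List.map_reverse]

theorem revList_append (l l' : List T.Dart) :
    revList (l ++ l') = revList l' ++ revList l := by
  simp [revList]

theorem length_revList (l : List T.Dart) : (revList l).length = l.length := by
  simp [revList]

theorem revList_infix {l l' : List T.Dart} : revList l <:+: revList l' ↔ l <:+: l' := by
  have h : ∀ {l l' : List T.Dart}, l <:+: l' → revList l <:+: revList l' := by
    rintro l _ ⟨s, t, rfl⟩
    exact ⟨revList t, revList s, by simp [revList_append]⟩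
  refine ⟨fun h' => ?_, h⟩
  simpa [revList_revList] using h h'

/-- Non-empty sequences of successive oriented edges without backtracking. -/
def IsTPath (l : List T.Dart) : Prop :=
  l ≠ [] ∧ l.IsChain fun e f => e.snd = f.fst ∧ f ≠ e.symm

variable (T) in
/-- The set of paths of `T`. -/
@[ext] structure TPath where
  /-- The sequence of oriented edges. -/
  edges : List T.Dart
  isTPath : IsTPath edges

theorem IsTPath.rev {l : List T.Dart} (h : IsTPath l) : IsTPath (revList l) := by
  refine ⟨by simpa [revList] using h.1, ?_⟩
  rw [revList, List.isChain_reverse, List.isChain_map]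
  refine h.2.imp fun e f hef => ⟨hef.1.symm, fun h' => hef.2 ?_⟩
  rw [h', SimpleGraph.Dart.symm_symm]

/-- The reverse path. -/
def TPath.rev (p : TPath T) : TPath T := ⟨revList p.edges, p.isTPath.rev⟩

@[simp] theorem TPath.rev_rev (p : TPath T) : p.rev.rev = p := TPath.ext (revList_revList p.edges)

/-- The length of a path. -/
def TPath.length (p : TPath T) : ℕ := p.edges.length

theorem TPath.length_rev (p : TPath T) : p.rev.length = p.length := length_revList p.edges

/-- The action of an automorphism on oriented edges. -/
def dartMap (φ : T ≃g T) (e : T.Dart) : T.Dart :=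
  ⟨(φ e.fst, φ e.snd), φ.map_adj_iff.2 e.adj⟩

theorem dartMap_symm (φ : T ≃g T) (e : T.Dart) : dartMap φ e.symm = (dartMap φ e).symm := rfl

theorem dartMap_injective (φ : T ≃g T) : Function.Injective (dartMap φ) := by
  intro e f h
  have h1 : φ e.fst = φ f.fst := congrArg (fun e : T.Dart => e.fst) h
  have h2 : φ e.snd = φ f.snd := congrArg (fun e : T.Dart => e.snd) h
  exact SimpleGraph.Dart.ext _ _ (Prod.ext (φ.injective h1) (φ.injective h2))

/-- The action of an automorphism on paths. -/
def TPath.act (φ : T ≃g T) (p : TPath T) : TPath T :=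
  ⟨p.edges.map (dartMap φ), by simpa using p.isTPath.1, by
    rw [List.isChain_map]
    refine p.isTPath.2.imp fun e f h => ⟨congrArg φ h.1, fun h' => h.2 (dartMap_injective φ h')⟩⟩

theorem TPath.act_one (p : TPath T) : p.act (1 : T ≃g T) = p :=
  TPath.ext ((List.map_congr_left fun _ _ => rfl).trans (List.map_id p.edges))

theorem TPath.act_mul (φ ψ : T ≃g T) (p : TPath T) : p.act (φ * ψ) = (p.act ψ).act φ :=
  TPath.ext (by simp only [act, List.map_map]; rfl)

theorem TPath.act_rev (φ : T ≃g T) (p : TPath T) : p.rev.act φ = (p.act φ).rev :=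
  TPath.ext (by simp only [act, rev, revList, List.map_reverse, List.map_map]; rfl)

theorem TPath.length_act (φ : T ≃g T) (p : TPath T) : (p.act φ).length = p.length := by
  simp [length, act]

/-- The permutation of the set of paths given by an automorphism. -/
def TPath.actEquiv (φ : T ≃g T) : TPath T ≃ TPath T where
  toFun := TPath.act φ
  invFun := TPath.act φ⁻¹
  left_inv p := by rw [← act_mul, inv_mul_cancel, act_one]
  right_inv p := by rw [← act_mul, mul_inv_cancel, act_one]

variable (T) in
/-- The elements of the free vector space on the set of paths that change sign when replacing
a path by its reverse. -/
def pathSubmodule : Submodule ℝ (TPath T →₀ ℝ) where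
  carrier := {f | ∀ p, f p.rev = -f p}
  add_mem' hf hg p := by simp [hf p, hg p]; ring
  zero_mem' p := by simp
  smul_mem' c f hf p := by simp [hf p]

variable (T) in
/-- The path module. -/
def PathMod : Type _ := pathSubmodule T

instance : AddCommGroup (PathMod T) := inferInstanceAs (AddCommGroup (pathSubmodule T))

instance : Module ℝ (PathMod T) := inferInstanceAs (Module ℝ (pathSubmodule T))

/-- The weighted norm `∑ₙ (1 / n!) ‖f‖_{n,1}`, where `‖f‖_{n,1}` is the `ℓ¹`-norm of the restriction
of `f` to the paths of length `n`. -/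
def pathNorm (f : TPath T →₀ ℝ) : ℝ := f.sum fun p r => 1 / (p.length.factorial : ℝ) * |r|

theorem pathNorm_eq_sum (f : TPath T →₀ ℝ) (s : Finset (TPath T)) (hs : f.support ⊆ s) :
    pathNorm f = ∑ p ∈ s, 1 / (p.length.factorial : ℝ) * |f p| :=
  Finsupp.sum_of_support_subset f hs _ (by simp)

theorem pathNorm_add_le (f g : TPath T →₀ ℝ) : pathNorm (f + g) ≤ pathNorm f + pathNorm g := by
  classical
  rw [pathNorm_eq_sum (f + g) (f.support ∪ g.support) Finsupp.support_add,
    pathNorm_eq_sum f (f.support ∪ g.support) Finset.subset_union_left,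
    pathNorm_eq_sum g (f.support ∪ g.support) Finset.subset_union_right,
    ← Finset.sum_add_distrib]
  refine Finset.sum_le_sum fun p _ => ?_
  rw [← mul_add]
  exact mul_le_mul_of_nonneg_left (abs_add_le _ _) (by positivity)

theorem pathNorm_smul (c : ℝ) (f : TPath T →₀ ℝ) : pathNorm (c • f) = |c| * pathNorm f := by
  rw [pathNorm_eq_sum (c • f) f.support Finsupp.support_smul,
    pathNorm_eq_sum f f.support subset_rfl, Finset.mul_sum]
  refine Finset.sum_congr rfl fun p _ => ?_
  rw [Finsupp.smul_apply, smul_eq_mul, abs_mul]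
  ring

theorem weight_mul_abs_le_pathNorm (f : TPath T →₀ ℝ) (p : TPath T) :
    1 / (p.length.factorial : ℝ) * |f p| ≤ pathNorm f := by
  classical
  rw [pathNorm_eq_sum f (insert p f.support) (Finset.subset_insert _ _)]
  exact Finset.single_le_sum (f := fun p => 1 / (p.length.factorial : ℝ) * |f p|)
    (fun p _ => by positivity) (Finset.mem_insert_self _ _)

instance : NormedAddCommGroup (PathMod T) :=
  AddGroupNorm.toNormedAddCommGroup
    { toFun := fun f => pathNorm f.1
      map_zero' := Finsupp.sum_zero_index
      add_le' := fun f g => pathNorm_add_le f.1 g.1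
      neg' := fun f => by
        have := pathNorm_smul (-1) f.1
        rw [abs_neg, abs_one, one_mul, neg_one_smul] at this
        exact this
      eq_zero_of_map_eq_zero' := fun f hf => Subtype.ext <| Finsupp.ext fun p => by
        have h : 1 / (p.length.factorial : ℝ) * |f.1 p| ≤ 0 :=
          (weight_mul_abs_le_pathNorm f.1 p).trans hf.le
        have h1 : 0 < 1 / (p.length.factorial : ℝ) := by positivity
        have h2 : |f.1 p| ≤ 0 := nonpos_of_mul_nonpos_right h h1
        exact abs_nonpos_iff.1 h2 }

theorem pathMod_norm_def (f : PathMod T) : ‖f‖ = pathNorm f.1 := rfl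

instance : NormedSpace ℝ (PathMod T) where
  norm_smul_le c f := (pathNorm_smul c f.1).le

variable (T) in
/-- The completion of the path module. -/
abbrev PathBan : Type _ := Completion (PathMod T)

/-- The action of an automorphism on the path module, `(φ f)(p) = f (φ⁻¹ p)`. -/
def pathAct (φ : T ≃g T) : PathMod T ≃ₗ[ℝ] PathMod T where
  toFun f := ⟨Finsupp.equivMapDomain (TPath.actEquiv φ) f.1, fun p => by
    have := f.2 (p.act φ⁻¹)
    simpa [Finsupp.equivMapDomain_apply, TPath.actEquiv, TPath.act_rev] using this⟩
  invFun f := ⟨Finsupp.equivMapDomain (TPath.actEquiv φ).symm f.1, fun p => by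
    have := f.2 (p.act φ)
    simpa [Finsupp.equivMapDomain_apply, TPath.actEquiv, TPath.act_rev] using this⟩
  map_add' f g := Subtype.ext <| Finsupp.ext fun p => by
    simp only [Finsupp.equivMapDomain_apply]; rfl
  map_smul' c f := Subtype.ext <| Finsupp.ext fun p => by
    simp only [Finsupp.equivMapDomain_apply]; rfl
  left_inv f := Subtype.ext <| Finsupp.ext fun p => by
    simp [Finsupp.equivMapDomain_apply]
  right_inv f := Subtype.ext <| Finsupp.ext fun p => by
    simp [Finsupp.equivMapDomain_apply]

theorem pathAct_apply (φ : T ≃g T) (f : PathMod T) (p : TPath T) :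
    (pathAct φ f).1 p = f.1 (p.act φ⁻¹) := rfl

variable (T) in
/-- The path module as an isometric `Aut(T)`-module. -/
def pathRep₀ : (T ≃g T) →* (PathMod T ≃ₗᵢ[ℝ] PathMod T) where
  toFun φ :=
    { toLinearEquiv := pathAct φ
      norm_map' := fun f => by
        change pathNorm (Finsupp.equivMapDomain (TPath.actEquiv φ) f.1) = pathNorm f.1
        unfold pathNorm
        rw [Finsupp.sum_equivMapDomain]
        refine Finset.sum_congr rfl fun p _ => ?_
        simp only [TPath.actEquiv, Equiv.coe_fn_mk, TPath.length_act] }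
  map_one' := LinearIsometryEquiv.ext fun f => Subtype.ext <| Finsupp.ext fun p => by
    change f.1 (p.act 1⁻¹) = f.1 p
    rw [inv_one, TPath.act_one]
  map_mul' φ ψ := LinearIsometryEquiv.ext fun f => Subtype.ext <| Finsupp.ext fun p => by
    change f.1 (p.act (φ * ψ)⁻¹) = f.1 ((p.act φ⁻¹).act ψ⁻¹)
    rw [mul_inv_rev, TPath.act_mul]

variable (T) in
/-- The completed path module as an isometric Banach `Aut(T)`-module. -/
def pathRep : (T ≃g T) →* (PathBan T ≃ₗᵢ[ℝ] PathBan T) := completionRep (pathRep₀ T)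

/-- `Aut(T)` carries the topology of pointwise convergence on the discrete set of vertices. -/
instance autTopology : TopologicalSpace (T ≃g T) :=
  TopologicalSpace.induced (fun φ : T ≃g T => (φ : V → V)) (@Pi.topologicalSpace V _ fun _ => ⊥)

/-- The element of the path module attached to a sequence `q` of oriented edges, with value
`1` at `p` if `p` is a sub-path of `q` and `-1` at `p` if the reverse of `p` is a sub-path of `q`
(both cannot happen if `q` is the path between two vertices of a tree). -/
def subpathSum (q : List T.Dart) : PathMod T := by
  classical
  exact ⟨Finsupp.ofSupportFinite
    (fun p => (if p.edges <:+: q then 1 else 0) - (if p.rev.edges <:+: q then 1 else 0)) (by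
      have h : {l : List T.Dart | l <:+: q}.Finite := by
        refine (q.sublists.finite_toSet).subset fun l hl => ?_
        exact List.mem_sublists.2 (List.IsInfix.sublist hl)
      refine ((h.preimage (f := fun p : TPath T => p.edges)
        (fun p _ p' _ hpp => TPath.ext hpp)).union
        (h.preimage (f := fun p : TPath T => p.rev.edges) ?_)).subset ?_
      · intro p _ p' _ hpp
        have := congrArg TPath.rev (TPath.ext hpp : p.rev = p'.rev)
        simpa using this
      · intro p hp
        by_contra hc
        simp only [Set.mem_union, Set.mem_preimage, Set.mem_ofPred_eq, not_or] at hc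
        simp [hc.1, hc.2] at hp), fun p => by simp [Finsupp.ofSupportFinite_coe]⟩

open Classical in
theorem subpathSum_apply (q : List T.Dart) (p : TPath T) : (subpathSum q).1 p =
    (if p.edges <:+: q then 1 else 0) - (if p.rev.edges <:+: q then 1 else 0) := rfl

/-- The path `[x, y]` connecting two vertices of a tree, as a sequence of oriented edges. -/
def geod (hT : T.IsTree) (x y : V) : List T.Dart := (hT.existsUnique_path x y).choose.darts

/-- The map `θ : V² → PathMod T`. -/
def theta (hT : T.IsTree) (x : Fin 2 → V) : PathMod T := subpathSum (geod hT (x 0) (x 1))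

/-- The cocycle `ω = dθ : V³ → PathMod T`. -/
def omega (hT : T.IsTree) : (Fin 3 → V) → PathMod T := cobd (theta hT)

theorem geod_eq (hT : T.IsTree) {x y : V} (p : T.Walk x y) (hp : p.IsPath) :
    geod hT x y = p.darts := by
  rw [geod, (hT.existsUnique_path x y).unique (hT.existsUnique_path x y).choose_spec.1 hp]

theorem geod_act (hT : T.IsTree) (φ : T ≃g T) (x y : V) :
    geod hT (φ x) (φ y) = (geod hT x y).map (dartMap φ) := by
  obtain ⟨p, hp, -⟩ := hT.existsUnique_path x y
  rw [geod_eq hT p hp]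
  refine (geod_eq hT (p.map φ.toHom) (hp.map φ.injective)).trans ?_
  rw [SimpleGraph.Walk.darts_map]
  rfl

theorem theta_act (hT : T.IsTree) (φ : T ≃g T) (x : Fin 2 → V) :
    theta hT (fun i => φ (x i)) = pathRep₀ T φ (theta hT x) := by
  classical
  have h : ∀ (p : TPath T) (q : List T.Dart),
      p.edges <:+: q.map (dartMap φ) ↔ (p.act φ⁻¹).edges <:+: q := by
    intro p q
    have hinv : ∀ ψ χ : T ≃g T, ψ * χ = 1 → ∀ l : List T.Dart,
        (l.map (dartMap χ)).map (dartMap ψ) = l := by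
      intro ψ χ h1 l
      rw [List.map_map]
      refine (List.map_congr_left fun e _ => ?_).trans (List.map_id l)
      change dartMap (ψ * χ) e = e
      rw [h1]
      rfl
    constructor
    · intro h
      have := h.map (dartMap φ⁻¹)
      rwa [hinv φ⁻¹ φ (inv_mul_cancel φ)] at this
    · intro h
      have := h.map (dartMap φ)
      rwa [TPath.act, hinv φ φ⁻¹ (mul_inv_cancel φ)] at this
  refine Subtype.ext <| Finsupp.ext fun p => ?_
  change (subpathSum _).1 p = (subpathSum _).1 (p.act φ⁻¹)
  rw [subpathSum_apply, subpathSum_apply, geod_act, ← TPath.act_rev]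
  simp only [h]

theorem omega_act (hT : T.IsTree) (φ : T ≃g T) (x : Fin 3 → V) :
    omega hT (fun i => φ (x i)) = pathRep₀ T φ (omega hT x) := by
  have h : ∀ i : Fin 3, theta hT (fun j => φ (x (i.succAbove j))) =
    pathRep₀ T φ (theta hT fun j => x (i.succAbove j)) := fun i => theta_act hT φ _
  simp only [omega, cobd, h, map_sum, map_zsmul]


theorem subpathSum_revList (q : List T.Dart) : subpathSum (revList q) = -subpathSum q := by
  classical
  refine Subtype.ext <| Finsupp.ext fun p => ?_
  change (subpathSum (revList q)).1 p = -(subpathSum q).1 p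
  rw [subpathSum_apply, subpathSum_apply]
  have h1 : p.edges <:+: revList q ↔ p.rev.edges <:+: q := by
    rw [← revList_infix, revList_revList]; rfl
  have h2 : p.rev.edges <:+: revList q ↔ p.edges <:+: q := revList_infix
  simp only [h1, h2, neg_sub]

theorem sum_one_div_factorial_le (n : ℕ) :
    ∑ i ∈ Finset.range n, 1 / (i.factorial : ℝ) ≤ Real.exp 1 := by
  simpa using Real.sum_le_exp_of_nonneg zero_le_one n

theorem sum_one_div_factorial_succ_le (n : ℕ) :
    ∑ i ∈ Finset.range n, 1 / ((i + 1).factorial : ℝ) ≤ Real.exp 1 := by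
  refine le_trans (Finset.sum_le_sum fun i _ => ?_) (sum_one_div_factorial_le n)
  refine one_div_le_one_div_of_le (by positivity) ?_
  exact_mod_cast Nat.factorial_le (Nat.le_succ i)

/-- The concatenations of a non-empty final segment of `a` and a non-empty initial segment
of `b`. -/
def straddle (a b : List T.Dart) : Set (List T.Dart) :=
  {l | ∃ i ∈ Finset.range a.length, ∃ j ∈ Finset.range b.length,
    l = a.drop i ++ b.take (j + 1)}

theorem straddle_of_infix {a b l : List T.Dart} (h : l <:+: a ++ b) :
    l <:+: a ∨ l <:+: b ∨ l ∈ straddle a b := by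
  obtain ⟨s, t, h⟩ := h
  rw [List.append_assoc, List.append_eq_append_iff] at h
  rcases h with ⟨c, ha, hb⟩ | ⟨c, hs, hb⟩
  · rw [List.append_eq_append_iff] at hb
    rcases hb with ⟨e, hc, -⟩ | ⟨e, hl, hb'⟩
    · left; exact ⟨s, e, by rw [ha, hc, List.append_assoc]⟩
    · by_cases hc0 : c = []
      · right; left
        subst hc0
        exact ⟨[], t, by rw [hb', hl]; simp⟩
      by_cases he0 : e = []
      · left
        subst he0
        exact ⟨s, [], by rw [ha, hl]; simp⟩
      right; right
      have h1 := List.length_pos_of_ne_nil hc0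
      have h2 := List.length_pos_of_ne_nil he0
      refine ⟨s.length, ?_, e.length - 1, ?_, ?_⟩
      · rw [Finset.mem_range, ha, List.length_append]; omega
      · rw [Finset.mem_range, hb', List.length_append]; omega
      · rw [ha, hb', hl, Nat.sub_add_cancel h2]; simp
  · right; left; exact ⟨c, t, by rw [hb, List.append_assoc]⟩

theorem straddle_infix {a b l : List T.Dart} (h : l ∈ straddle a b) (hn : (a ++ b).Nodup) :
    l <:+: a ++ b ∧ ¬ l <:+: a ∧ ¬ l <:+: b := by
  obtain ⟨i, hi, j, hj, rfl⟩ := h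
  rw [Finset.mem_range] at hi hj
  have hd := (List.nodup_append.1 hn).2.2
  refine ⟨⟨a.take i, b.drop (j + 1), ?_⟩, fun h => ?_, fun h => ?_⟩
  · rw [List.append_assoc, List.append_assoc, List.take_append_drop, ← List.append_assoc,
      List.take_append_drop]
  · have h0 : b[0] ∈ a.drop i ++ b.take (j + 1) :=
      List.mem_append_right _ (by
        rw [List.mem_take_iff_getElem]; exact ⟨0, by omega, rfl⟩)
    exact hd _ (h.subset h0) _ (List.getElem_mem _) rfl
  · have h0 : a[i] ∈ a.drop i ++ b.take (j + 1) :=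
      List.mem_append_left _ (by
        rw [List.mem_drop_iff_getElem]; exact ⟨0, by omega, by simp⟩)
    exact hd _ (List.getElem_mem _) _ (h.subset h0) rfl

theorem norm_subpathSum_append (a b : List T.Dart) (hn : (a ++ b).Nodup) :
    ‖subpathSum (a ++ b) - subpathSum a - subpathSum b‖ ≤ 4 * Real.exp 1 ^ 2 := by
  classical
  set f : PathMod T := subpathSum (a ++ b) - subpathSum a - subpathSum b with hf
  let u : List T.Dart → ℝ := fun l =>
    (if l <:+: a ++ b then 1 else 0) - (if l <:+: a then 1 else 0) - (if l <:+: b then 1 else 0)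
  have hfu : ∀ p : TPath T, f.1 p = u p.edges - u p.rev.edges := by
    intro p
    have : f.1 p = (subpathSum (a ++ b)).1 p - (subpathSum a).1 p - (subpathSum b).1 p := rfl
    rw [this, subpathSum_apply, subpathSum_apply, subpathSum_apply]
    ring
  have hu : ∀ l : List T.Dart, l ≠ [] → l ∉ straddle a b → u l = 0 := by
    intro l hl0 hl
    have hd := (List.nodup_append.1 hn).2.2
    by_cases h1 : l <:+: a
    · have h2 : ¬ l <:+: b := fun h2 => by
        obtain ⟨e, he⟩ := List.exists_mem_of_ne_nil l hl0
        exact hd _ (h1.subset he) _ (h2.subset he) rfl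
      have h3 : l <:+: a ++ b := h1.trans ⟨[], b, by simp⟩
      simp [u, h1, h2, h3]
    · by_cases h2 : l <:+: b
      · have h3 : l <:+: a ++ b := h2.trans ⟨a, [], by simp⟩
        simp [u, h1, h2, h3]
      · have h3 : ¬ l <:+: a ++ b := fun h3 => by
          rcases straddle_of_infix h3 with h | h | h
          · exact h1 h
          · exact h2 h
          · exact hl h
        simp [u, h1, h2, h3]
  have hu1 : ∀ l : List T.Dart, l ∈ straddle a b → u l = 1 := by
    intro l hl
    obtain ⟨h1, h2, h3⟩ := straddle_infix hl hn
    simp [u, h1, h2, h3]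
  let S : Finset (List T.Dart) := (Finset.range a.length ×ˢ Finset.range b.length).image
    fun ij => a.drop ij.1 ++ b.take (ij.2 + 1)
  have hS : ∀ l, l ∈ S ↔ l ∈ straddle a b := by
    intro l
    simp only [S, straddle, Finset.mem_image, Finset.mem_product, Set.mem_ofPred_eq]
    constructor
    · rintro ⟨⟨i, j⟩, ⟨hi, hj⟩, rfl⟩; exact ⟨i, hi, j, hj, rfl⟩
    · rintro ⟨i, hi, j, hj, rfl⟩; exact ⟨⟨i, j⟩, ⟨hi, hj⟩, rfl⟩
  let wt : List T.Dart → ℝ := fun l => 1 / (l.length.factorial : ℝ)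
  have hwt : ∀ l, 0 ≤ wt l := fun l => by positivity
  have hsumS : ∑ l ∈ S, wt l ≤ Real.exp 1 ^ 2 := by
    refine (Finset.sum_image_le_of_nonneg (fun l _ => hwt l)).trans ?_
    have hA : ∑ i ∈ Finset.range a.length, 1 / ((a.length - i).factorial : ℝ) ≤ Real.exp 1 := by
      refine le_trans (le_of_eq ?_) (sum_one_div_factorial_succ_le a.length)
      rw [← Finset.sum_range_reflect]
      refine Finset.sum_congr rfl fun i hi => ?_
      rw [Finset.mem_range] at hi
      rw [show a.length - (a.length - 1 - i) = i + 1 by omega]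
    have hB := sum_one_div_factorial_succ_le b.length
    have hAB := mul_le_mul hA hB (Finset.sum_nonneg fun i _ => by positivity) (by positivity)
    rw [pow_two]
    refine le_trans ?_ hAB
    rw [Finset.sum_mul_sum, ← Finset.sum_product']
    refine Finset.sum_le_sum fun ij hij => ?_
    rw [Finset.mem_product, Finset.mem_range, Finset.mem_range] at hij
    have hl : (a.drop ij.1 ++ b.take (ij.2 + 1)).length = (a.length - ij.1) + (ij.2 + 1) := by
      simp; omega
    simp only [wt, hl]
    rw [one_div_mul_one_div]
    refine one_div_le_one_div_of_le (by positivity) ?_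
    exact_mod_cast Nat.le_of_dvd (Nat.factorial_pos _) (Nat.factorial_mul_factorial_dvd_factorial_add _ _)
  have key : ∀ (P : Finset (TPath T)) (e : TPath T → List T.Dart), Function.Injective e →
      (∀ p, (e p).length = p.length) → (∀ p, e p ≠ []) →
      ∑ p ∈ P, 1 / (p.length.factorial : ℝ) * |u (e p)| ≤ Real.exp 1 ^ 2 := by
    intro P e he hlen hne
    have h1 : ∑ p ∈ P, 1 / (p.length.factorial : ℝ) * |u (e p)| =
        ∑ l ∈ P.image e, wt l * |u l| := by
      rw [Finset.sum_image he.injOn]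
      exact Finset.sum_congr rfl fun p _ => by rw [← hlen p]
    rw [h1]
    refine le_trans ?_ hsumS
    rw [← Finset.sum_filter_add_sum_filter_not (P.image e) (fun l => l ∈ S)]
    have h2 : ∑ l ∈ (P.image e).filter (fun l => ¬ l ∈ S), wt l * |u l| = 0 := by
      refine Finset.sum_eq_zero fun l hl => ?_
      rw [Finset.mem_filter, Finset.mem_image] at hl
      obtain ⟨⟨p, -, rfl⟩, hl⟩ := hl
      rw [hu _ (hne p) (fun h => hl ((hS _).2 h)), abs_zero, mul_zero]
    rw [h2, add_zero]
    refine (Finset.sum_le_sum_of_subset_of_nonneg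
      (t := S) (fun l hl => (Finset.mem_filter.1 hl).2)
      (fun l _ _ => mul_nonneg (hwt l) (abs_nonneg _))).trans ?_
    refine Finset.sum_le_sum fun l hl => ?_
    rw [hu1 l ((hS l).1 hl), abs_one, mul_one]
  rw [pathMod_norm_def, pathNorm_eq_sum f.1 f.1.support subset_rfl]
  have h1 := key f.1.support TPath.edges (fun p p' h => TPath.ext h) (fun p => rfl)
    (fun p => p.isTPath.1)
  have h2 := key f.1.support (fun p => p.rev.edges)
    (fun p p' h => by
      have := congrArg TPath.rev (TPath.ext h : p.rev = p'.rev)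
      simpa using this)
    (fun p => p.length_rev) (fun p => p.rev.isTPath.1)
  have h3 : ∑ p ∈ f.1.support, 1 / (p.length.factorial : ℝ) * |f.1 p| ≤
      ∑ p ∈ f.1.support, 1 / (p.length.factorial : ℝ) * |u p.edges| +
      ∑ p ∈ f.1.support, 1 / (p.length.factorial : ℝ) * |u p.rev.edges| := by
    rw [← Finset.sum_add_distrib]
    refine Finset.sum_le_sum fun p _ => ?_
    rw [← mul_add, hfu]
    exact mul_le_mul_of_nonneg_left (abs_sub _ _) (by positivity)
  have h4 : 0 ≤ Real.exp 1 ^ 2 := by positivity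
  linarith

/-- Any two paths of a tree starting from the same vertex branch off exactly once. -/
theorem exists_branch (hT : T.IsTree) {x y z : V} (p : T.Walk x y) (hp : p.IsPath) :
    ∀ (q : T.Walk x z), q.IsPath → ∃ (c : V) (a : T.Walk x c) (p' : T.Walk c y) (q' : T.Walk c z),
      p = a.append p' ∧ q = a.append q' ∧ (p'.reverse.append q').IsPath := by
  induction p with
  | nil =>
    intro q hq
    exact ⟨_, .nil, .nil, q, rfl, rfl, by simpa using hq⟩
  | @cons x v y h p ih =>
    intro q hq
    cases q with
    | nil => exact ⟨_, .nil, .cons h p, .nil, rfl, rfl, by simpa using hp.reverse⟩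
    | @cons _ v' _ h' q =>
      by_cases hv : v = v'
      · subst hv
        obtain ⟨c, a, p', q', e1, e2, e3⟩ := ih hp.of_cons q hq.of_cons
        exact ⟨c, .cons h a, p', q', by rw [e1]; rfl, by rw [e2]; rfl, e3⟩
      · refine ⟨_, .nil, .cons h p, .cons h' q, rfl, rfl, ?_⟩
        have c1 := (hT.isAcyclic.isPath_iff_isChain _).1 hp.reverse
        have c2 := (hT.isAcyclic.isPath_iff_isChain _).1 hq
        rw [hT.isAcyclic.isPath_iff_isChain, SimpleGraph.Walk.edges_append, List.isChain_append]
        refine ⟨c1, c2, ?_⟩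
        intro e he f hf
        simp only [SimpleGraph.Walk.edges_reverse, SimpleGraph.Walk.edges_cons,
          List.getLast?_reverse, List.head?_cons, Option.mem_some_iff] at he hf
        subst he hf
        intro heq
        rw [Sym2.congr_right] at heq
        exact hv heq

theorem exists_tripod (hT : T.IsTree) (x y z : V) : ∃ a b c : List T.Dart,
    geod hT x y = a ++ revList b ∧ geod hT y z = b ++ revList c ∧
      geod hT x z = a ++ revList c := by
  obtain ⟨p, hp, -⟩ := hT.existsUnique_path x y
  obtain ⟨q, hq, -⟩ := hT.existsUnique_path x z
  obtain ⟨c, a, p', q', e1, e2, e3⟩ := exists_branch hT p hp q hq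
  refine ⟨a.darts, p'.reverse.darts, q'.reverse.darts, ?_, ?_, ?_⟩
  · rw [geod_eq hT p hp, e1]
    simp [revList, SimpleGraph.Walk.darts_append, SimpleGraph.Walk.darts_reverse, List.map_reverse]
  · rw [geod_eq hT _ e3]
    simp [revList, SimpleGraph.Walk.darts_append, SimpleGraph.Walk.darts_reverse, List.map_reverse]
  · rw [geod_eq hT q hq, e2]
    simp [revList, SimpleGraph.Walk.darts_append, SimpleGraph.Walk.darts_reverse, List.map_reverse]

theorem geod_nodup (hT : T.IsTree) (x y : V) : (geod hT x y).Nodup := by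
  obtain ⟨p, hp, -⟩ := hT.existsUnique_path x y
  rw [geod_eq hT p hp]
  exact List.Nodup.of_map _ hp.isTrail.edges_nodup

theorem omega_apply (hT : T.IsTree) (x : Fin 3 → V) : omega hT x =
    subpathSum (geod hT (x 1) (x 2)) - subpathSum (geod hT (x 0) (x 2)) +
      subpathSum (geod hT (x 0) (x 1)) := by
  have h : ∀ i : Fin 3, theta hT (fun j => x (i.succAbove j)) =
    subpathSum (geod hT (x (i.succAbove 0)) (x (i.succAbove 1))) := fun _ => rfl
  have e : omega hT x = ∑ i : Fin 3, (-1 : ℤ) ^ (i : ℕ) • theta hT (fun j => x (i.succAbove j)) :=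
    rfl
  rw [e, Fin.sum_univ_three, h, h, h]
  have a1 : (0 : Fin 3).succAbove (0 : Fin 2) = 1 := rfl
  have a2 : (0 : Fin 3).succAbove (1 : Fin 2) = 2 := rfl
  have a3 : (1 : Fin 3).succAbove (0 : Fin 2) = 0 := rfl
  have a4 : (1 : Fin 3).succAbove (1 : Fin 2) = 2 := rfl
  have a5 : (2 : Fin 3).succAbove (0 : Fin 2) = 0 := rfl
  have a6 : (2 : Fin 3).succAbove (1 : Fin 2) = 1 := rfl
  rw [a1, a2, a3, a4, a5, a6]
  simp [sub_eq_add_neg]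

theorem norm_omega_le (hT : T.IsTree) (x : Fin 3 → V) : ‖omega hT x‖ ≤ 12 * Real.exp 1 ^ 2 := by
  obtain ⟨a, b, c, h1, h2, h3⟩ := exists_tripod hT (x 0) (x 1) (x 2)
  have n1 := norm_subpathSum_append a (revList b) (h1 ▸ geod_nodup hT _ _)
  have n2 := norm_subpathSum_append b (revList c) (h2 ▸ geod_nodup hT _ _)
  have n3 := norm_subpathSum_append a (revList c) (h3 ▸ geod_nodup hT _ _)
  have e : omega hT x =
      (subpathSum (b ++ revList c) - subpathSum b - subpathSum (revList c)) -
      (subpathSum (a ++ revList c) - subpathSum a - subpathSum (revList c)) +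
      (subpathSum (a ++ revList b) - subpathSum a - subpathSum (revList b)) := by
    rw [omega_apply, h1, h2, h3, subpathSum_revList b]
    abel
  rw [e]
  refine (norm_add_le _ _).trans ?_
  have := norm_sub_le (subpathSum (b ++ revList c) - subpathSum b - subpathSum (revList c))
    (subpathSum (a ++ revList c) - subpathSum a - subpathSum (revList c))
  linarith

/-- The evaluation of `ω` along the orbit of a vertex `v`, as a map `Aut(T)³ → PathBan T`. -/
def omegaCochain (hT : T.IsTree) (v : V) : (Fin 3 → (T ≃g T)) → PathBan T :=
  fun g => (omega hT fun i => g i v : PathMod T)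

theorem continuous_orbit {A : Type*} [TopologicalSpace A] {n : ℕ} (v : V) (f : (Fin n → V) → A) :
    Continuous fun g : Fin n → (T ≃g T) => f fun i => g i v := by
  let _ : TopologicalSpace V := ⊥
  have : DiscreteTopology V := ⟨rfl⟩
  have h : Continuous fun φ : T ≃g T => φ v :=
    (continuous_apply v).comp (continuous_induced_dom (f := fun φ : T ≃g T => (φ : V → V)))
  have h2 : Continuous fun (g : Fin n → (T ≃g T)) (i : Fin n) => g i v :=
    continuous_pi fun i => h.comp (continuous_apply i)
  exact (continuous_of_discreteTopology (f := f)).comp h2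

theorem omegaCochain_mem (hT : T.IsTree) (v : V) : omegaCochain hT v ∈ cocycles (pathRep T) 2 := by
  refine ⟨⟨continuous_orbit v fun x => ((omega hT x : PathMod T) : PathBan T),
    ⟨12 * Real.exp 1 ^ 2, fun g => ?_⟩, fun φ g => ?_⟩, ?_⟩
  · rw [omegaCochain, Completion.norm_coe]
    exact norm_omega_le hT _
  · have := omega_act hT φ (fun i => g i v)
    refine Eq.trans ?_ (completionRep_coe (pathRep₀ T) φ (omega hT fun i => g i v)).symm
    rw [← this]
    rfl
  · change cobd (omegaCochain hT v) = 0
    funext g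
    have h : cobd (omegaCochain hT v) g =
        ((cobd (omega hT) (fun i => g i v) : PathMod T) : PathBan T) := by
      have hs := map_sum (Completion.toComplL (𝕜 := ℝ) (E := PathMod T))
        (fun i : Fin 4 => (-1 : ℤ) ^ (i : ℕ) • omega hT fun j => g (i.succAbove j) v) Finset.univ
      simp only [map_zsmul] at hs
      exact hs.symm
    rw [h, omega, cobd_cobd]
    simp

/-- The class `[ω] ∈ H_cb²(Aut(T), PathBan T)`, through the orbit of the vertex `v`. -/
def omegaClass (hT : T.IsTree) (v : V) : Hcb (pathRep T) 2 :=
  cls (omegaCochain hT v) (omegaCochain_mem hT v)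

end Tree

section FreeGroups

open UniformSpace

variable (α : Type*)

/-- Free groups are considered as discrete groups. -/
instance freeGroupTopology : TopologicalSpace (FreeGroup α) := ⊥

instance : DiscreteTopology (FreeGroup α) := ⟨rfl⟩

/-- The tree of the free group on `α`: its Cayley graph for the free generators, with vertex set
`FreeGroup α` and an edge between `g` and `g * s` for every generator `s`. -/
def freeTree : SimpleGraph (FreeGroup α) := SimpleGraph.mulCayley (Set.range FreeGroup.of)

variable {α}

/-- The group element `s` or `s⁻¹` given by a letter. -/
def letter (s : α × Bool) : FreeGroup α := FreeGroup.mk [s]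

theorem letter_ne_one (s : α × Bool) : letter s ≠ 1 := by
  classical
  intro h
  have := congrArg FreeGroup.toWord h
  rw [letter, FreeGroup.toWord_mk, FreeGroup.reduce_singleton, FreeGroup.toWord_one] at this
  exact List.cons_ne_nil _ _ this

theorem letter_injective : Function.Injective (letter : α × Bool → FreeGroup α) := by
  classical
  intro s t h
  have := congrArg FreeGroup.toWord h
  simpa [letter, FreeGroup.toWord_mk, FreeGroup.reduce_singleton] using this

theorem freeTree_adj {x y : FreeGroup α} :
    (freeTree α).Adj x y ↔ ∃ s : α × Bool, x⁻¹ * y = letter s := by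
  rw [freeTree, SimpleGraph.mulCayley_adj]
  constructor
  · rintro ⟨-, ⟨a, ha⟩ | ⟨a, ha⟩⟩
    · exact ⟨(a, true), ha.symm⟩
    · refine ⟨(a, false), ?_⟩
      have : x⁻¹ * y = (FreeGroup.of a)⁻¹ := by rw [ha]; group
      rw [this]
      rfl
  · rintro ⟨⟨a, b⟩, h⟩
    refine ⟨?_, ?_⟩
    · rintro rfl
      exact letter_ne_one _ (by rw [← h, inv_mul_cancel])
    · cases b with
      | true => exact Or.inl ⟨a, h.symm⟩
      | false =>
        refine Or.inr ⟨a, ?_⟩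
        have h' : y⁻¹ * x = (letter (a, false))⁻¹ := by rw [← h]; group
        rw [h']
        rfl

/-- The sequence of letters along a walk. -/
theorem exists_word_of_isPath {x y : FreeGroup α} (p : (freeTree α).Walk x y) (hp : p.IsPath) :
    ∃ L : List (α × Bool), FreeGroup.IsReduced L ∧ FreeGroup.mk L = x⁻¹ * y ∧
      p.darts.map (fun e => e.fst⁻¹ * e.snd) = L.map letter := by
  induction p with
  | nil => exact ⟨[], by simp, by simp [FreeGroup.one_eq_mk], rfl⟩
  | @cons x v y h p ih =>
    obtain ⟨L, h1, h2, h3⟩ := ih hp.of_cons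
    obtain ⟨s, hs⟩ := freeTree_adj.1 h
    refine ⟨s :: L, ?_, ?_, ?_⟩
    · cases p with
      | nil =>
        have : L = [] := by simpa using h3.symm
        subst this
        simp
      | @cons _ u _ h' p =>
        cases L with
        | nil => simp at h3
        | cons t L =>
          rw [FreeGroup.isReduced_cons_cons]
          refine ⟨fun hst => ?_, h1⟩
          by_contra hne
          have ht : v⁻¹ * u = letter t := by
            simp only [SimpleGraph.Walk.darts_cons, List.map_cons, List.cons.injEq] at h3
            exact h3.1
          have hst' : letter s * letter t = 1 := by
            obtain ⟨a, b⟩ := s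
            obtain ⟨a', b'⟩ := t
            simp only at hst hne
            subst hst
            have : b' = !b := by cases b <;> cases b' <;> simp_all
            subst this
            rw [letter, letter, FreeGroup.mul_mk]
            exact Quot.sound (FreeGroup.Red.Step.not (L₁ := []) (L₂ := []))
          have hxu : x = u := by
            have : x⁻¹ * u = 1 := by
              rw [← hst', ← hs, ← ht]; group
            exact (inv_mul_eq_one.1 this)
          subst hxu
          have := (SimpleGraph.Walk.cons_isPath_iff _ _).1 hp
          exact this.2 (by simp)
    · have : FreeGroup.mk (s :: L) = letter s * FreeGroup.mk L := by
        rw [letter, FreeGroup.mul_mk]; rfl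
      rw [this, h2, ← hs]
      group
    · simp [h3, hs]

theorem walk_eq_of_labels {x y : FreeGroup α} (p q : (freeTree α).Walk x y)
    (h : p.darts.map (fun e => e.fst⁻¹ * e.snd) = q.darts.map (fun e => e.fst⁻¹ * e.snd)) :
    p = q := by
  induction p with
  | nil =>
    cases q with
    | nil => rfl
    | cons h' q => simp at h
  | @cons x v y h1 p ih =>
    cases q with
    | nil => simp at h
    | @cons _ v' _ h2 q =>
      simp only [SimpleGraph.Walk.darts_cons, List.map_cons, List.cons.injEq] at h
      have : v = v' := mul_left_cancel h.1
      subst this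
      rw [ih q h.2]

theorem freeTree_isTree : (freeTree α).IsTree := by
  classical
  refine ⟨⟨?_⟩, ?_⟩
  · have h : ∀ (L : List (α × Bool)) (x : FreeGroup α),
        (freeTree α).Reachable x (x * FreeGroup.mk L) := by
      intro L
      induction L with
      | nil => intro x; simp [← FreeGroup.one_eq_mk]
      | cons s L ih =>
        intro x
        have e : x * FreeGroup.mk (s :: L) = x * letter s * FreeGroup.mk L := by
          rw [mul_assoc, letter, FreeGroup.mul_mk]; rfl
        rw [e]
        refine SimpleGraph.Reachable.trans ?_ (ih _)
        exact SimpleGraph.Adj.reachable (freeTree_adj.2 ⟨s, by group⟩)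
    intro x y
    have := h (x⁻¹ * y).toWord x
    rwa [FreeGroup.mk_toWord, mul_inv_cancel_left] at this
  · refine SimpleGraph.isAcyclic_iff_subsingleton_path.2 fun x y => ⟨fun p q => ?_⟩
    obtain ⟨L, h1, h2, h3⟩ := exists_word_of_isPath p.1 p.2
    obtain ⟨L', h1', h2', h3'⟩ := exists_word_of_isPath q.1 q.2
    have : L = L' := by
      rw [← h1.reduce_eq, ← h1'.reduce_eq]
      exact FreeGroup.reduce.sound (h2.trans h2'.symm)
    exact Subtype.ext (walk_eq_of_labels _ _ (by rw [h3, h3', this]))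

variable (α) in
/-- The embedding of the free group into the automorphism group of its tree, by left
multiplication. -/
def leftMul : FreeGroup α →* (freeTree α ≃g freeTree α) where
  toFun g := ⟨Equiv.mulLeft g, SimpleGraph.mulCayley_adj_mul_iff_right⟩
  map_one' := by ext x; simp
  map_mul' g h := by ext x; exact mul_assoc g h x

theorem continuous_leftMul : Continuous (leftMul α) := continuous_of_discreteTopology

/-- The word `w` labels the path `p`: the successive edges of `p` are `(g, g * s)` for the
successive letters `s` of `w`. -/
def Labels (w : List (α × Bool)) (p : TPath (freeTree α)) : Prop :=
  p.edges.map (fun e => e.fst⁻¹ * e.snd) = w.map letter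

open Classical in
/-- The value of `λ_w` on an individual path. -/
def lambdaVal (w : List (α × Bool)) (p : TPath (freeTree α)) : ℝ :=
  if Labels w p then 1 else if Labels w p.rev then -1 else 0

theorem Labels.length {w : List (α × Bool)} {p : TPath (freeTree α)} (h : Labels w p) :
    p.length = w.length := by
  have := congrArg List.length h
  simpa [TPath.length] using this

theorem labels_act (g : FreeGroup α) (w : List (α × Bool)) (p : TPath (freeTree α)) :
    Labels w (p.act (leftMul α g)) ↔ Labels w p := by
  have : (p.act (leftMul α g)).edges.map (fun e => e.fst⁻¹ * e.snd) =
      p.edges.map (fun e => e.fst⁻¹ * e.snd) := by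
    simp only [TPath.act, List.map_map]
    refine List.map_congr_left fun e _ => ?_
    change (g * e.fst)⁻¹ * (g * e.snd) = e.fst⁻¹ * e.snd
    group
  rw [Labels, this, Labels]

theorem lambdaVal_act (g : FreeGroup α) (w : List (α × Bool)) (p : TPath (freeTree α)) :
    lambdaVal w (p.act (leftMul α g)) = lambdaVal w p := by
  have h1 := labels_act g w p
  have h2 := labels_act g w p.rev
  rw [TPath.act_rev] at h2
  unfold lambdaVal
  by_cases h3 : Labels w p <;> by_cases h4 : Labels w p.rev <;> simp [h1, h2, h3, h4]

theorem abs_lambdaVal_le (w : List (α × Bool)) (p : TPath (freeTree α)) :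
    |lambdaVal w p| ≤ w.length.factorial * (1 / (p.length.factorial : ℝ)) := by
  have h1 : p.length = w.length → |lambdaVal w p| ≤
      w.length.factorial * (1 / (p.length.factorial : ℝ)) := by
    intro h
    rw [h, mul_one_div_cancel (by positivity)]
    unfold lambdaVal
    split_ifs <;> simp
  by_cases h2 : Labels w p
  · exact h1 h2.length
  · by_cases h3 : Labels w p.rev
    · exact h1 (p.length_rev ▸ h3.length)
    · simp only [lambdaVal, h2, h3, if_false, abs_zero]
      positivity

/-- The linear form `λ_w` on the path module. Here an individual path `p` stands for the element
`p - p̄` of the path module; as `f = ½ ∑ₚ f(p) (p - p̄)` for every `f` in the path module, the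
linear form with the value `lambdaVal w p` on each `p - p̄` is `f ↦ ½ ∑ₚ f(p) lambdaVal w p`
(see `lambda₀_path`). -/
def lambda₀ (w : List (α × Bool)) : PathMod (freeTree α) →L[ℝ] ℝ :=
  LinearMap.mkContinuous
    { toFun := fun f => (1 / 2 : ℝ) * f.1.sum fun p r => r * lambdaVal w p
      map_add' := fun f g => by
        change _ * (f.1 + g.1).sum _ = _
        rw [Finsupp.sum_add_index' (by simp) (by intros; ring), mul_add]
      map_smul' := fun c f => by
        change _ * (c • f.1).sum _ = _
        rw [Finsupp.sum_smul_index' (by simp)]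
        simp only [smul_eq_mul, RingHom.id_apply, Finsupp.mul_sum]
        exact Finset.sum_congr rfl fun p _ => by ring }
    w.length.factorial (fun f => by
      change |(1 / 2 : ℝ) * ∑ p ∈ f.1.support, f.1 p * lambdaVal w p| ≤ _ * pathNorm f.1
      rw [pathNorm, Finsupp.sum, abs_mul, Finset.mul_sum]
      have h : |∑ p ∈ f.1.support, f.1 p * lambdaVal w p| ≤ ∑ p ∈ f.1.support,
          (w.length.factorial : ℝ) * (1 / (p.length.factorial : ℝ) * |f.1 p|) := by
        refine (Finset.abs_sum_le_sum_abs _ _).trans (Finset.sum_le_sum fun p _ => ?_)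
        rw [abs_mul]
        have := mul_le_mul_of_nonneg_left (abs_lambdaVal_le w p) (abs_nonneg (f.1 p))
        linarith
      have h2 : |(1 / 2 : ℝ)| ≤ 1 := by norm_num [abs_of_pos]
      have := mul_le_mul h2 h (abs_nonneg _) zero_le_one
      linarith)

theorem lambda₀_apply (w : List (α × Bool)) (f : PathMod (freeTree α)) :
    lambda₀ w f = (1 / 2 : ℝ) * f.1.sum fun p r => r * lambdaVal w p := rfl

/-- An individual path `p`, viewed as the element `p - p̄` of the path module. -/
def pathElt (p : TPath (freeTree α)) : PathMod (freeTree α) := by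
  classical
  exact ⟨Finsupp.single p 1 - Finsupp.single p.rev 1, fun q => by
    have h1 : p = q.rev ↔ p.rev = q :=
      ⟨fun h => by rw [h, TPath.rev_rev], fun h => by rw [← h, TPath.rev_rev]⟩
    have h2 : p.rev = q.rev ↔ p = q :=
      ⟨fun h => by rw [← p.rev_rev, h, TPath.rev_rev], fun h => by rw [h]⟩
    simp [Finsupp.single_apply, h1, h2]⟩

theorem not_labels_rev {w : List (α × Bool)} {p : TPath (freeTree α)} (h : Labels w p) :
    ¬ Labels w p.rev := by
  intro h'
  have hl : ∀ (i : ℕ) (hi : i < p.edges.length), p.edges[i].fst⁻¹ * p.edges[i].snd =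
      (p.edges[p.edges.length - 1 - i].fst⁻¹ * p.edges[p.edges.length - 1 - i].snd)⁻¹ := by
    intro i hi
    have e : p.rev.edges.map (fun e => e.fst⁻¹ * e.snd) =
      p.edges.map (fun e => e.fst⁻¹ * e.snd) := h'.trans h.symm
    have hi' : i < p.rev.edges.length := by
      rw [show p.rev.edges.length = p.edges.length from p.length_rev]; exact hi
    have e2 : (p.rev.edges.map (fun e => e.fst⁻¹ * e.snd))[i]'(by simpa using hi') =
        (p.edges.map (fun e => e.fst⁻¹ * e.snd))[i]'(by simpa using hi) := by simp only [e]
    rw [List.getElem_map, List.getElem_map] at e2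
    rw [← e2]
    simp [TPath.rev, revList]
  have hpos : 0 < p.edges.length := List.length_pos_of_ne_nil p.isTPath.1
  rcases Nat.even_or_odd' p.edges.length with ⟨m, hm | hm⟩
  · have h1 := hl m (by omega)
    have hch := List.isChain_iff_getElem.1 p.isTPath.2 (m - 1) (by omega)
    have e1 : p.edges.length - 1 - m = m - 1 := by omega
    have e2 : m - 1 + 1 = m := by omega
    simp only [e1] at h1
    simp only [e2] at hch
    refine hch.2 (SimpleGraph.Dart.ext _ _ (Prod.ext hch.1.symm ?_))
    have h3 := hch.1
    change p.edges[m].snd = p.edges[m - 1].fst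
    rw [mul_inv_rev, inv_inv, h3] at h1
    exact mul_left_cancel h1
  · have h1 := hl m (by omega)
    have e1 : p.edges.length - 1 - m = m := by omega
    simp only [e1] at h1
    obtain ⟨s, hs⟩ := freeTree_adj.1 p.edges[m].adj
    rw [hs] at h1
    have hinv : (letter s)⁻¹ = letter (s.1, !s.2) := rfl
    rw [hinv] at h1
    have := congrArg Prod.snd (letter_injective h1)
    simp at this

theorem lambdaVal_rev (w : List (α × Bool)) (p : TPath (freeTree α)) :
    lambdaVal w p.rev = -lambdaVal w p := by
  unfold lambdaVal
  rw [TPath.rev_rev]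
  by_cases h : Labels w p
  · simp [h, not_labels_rev h]
  · by_cases h' : Labels w p.rev <;> simp [h, h']

/-- `λ_w` takes the prescribed values on individual paths. -/
theorem lambda₀_path (w : List (α × Bool)) (p : TPath (freeTree α)) :
    lambda₀ w (pathElt p) = lambdaVal w p := by
  change (1 / 2 : ℝ) * (Finsupp.single p (1 : ℝ) - Finsupp.single p.rev 1).sum _ = _
  rw [Finsupp.sum_sub_index (by intros; ring), Finsupp.sum_single_index (by simp),
    Finsupp.sum_single_index (by simp), lambdaVal_rev]
  ring

/-- `λ_w` on the completed path module. -/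
def lambda (w : List (α × Bool)) : PathBan (freeTree α) →L[ℝ] ℝ := (lambda₀ w).fromCompletion

theorem lambda₀_invariant (w : List (α × Bool)) (g : FreeGroup α) (f : PathMod (freeTree α)) :
    lambda₀ w (pathRep₀ (freeTree α) (leftMul α g) f) = lambda₀ w f := by
  rw [lambda₀_apply, lambda₀_apply]
  change _ * (Finsupp.equivMapDomain (TPath.actEquiv (leftMul α g)) f.1).sum _ = _
  rw [Finsupp.sum_equivMapDomain]
  refine congrArg _ (Finset.sum_congr rfl fun p _ => ?_)
  exact congrArg _ (lambdaVal_act g w p)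

theorem lambda_invariant (w : List (α × Bool)) (g : FreeGroup α) (f : PathBan (freeTree α)) :
    lambda w (pathRep (freeTree α) (leftMul α g) f) = lambda w f := by
  refine Completion.induction_on f (isClosed_eq ?_ (lambda w).continuous) fun a => ?_
  · exact (lambda w).continuous.comp (pathRep (freeTree α) (leftMul α g)).continuous
  · rw [pathRep, completionRep_coe, lambda, ContinuousLinearMap.fromCompletion_apply_coe,
      ContinuousLinearMap.fromCompletion_apply_coe, lambda₀_invariant]

theorem lambdaTensor_equivariant (w w' : List (α × Bool)) (g : FreeGroup α)
    (t : ProjCompl (PathBan (freeTree α)) (PathBan (freeTree α))) :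
    tensorForm (lambda w) (lambda w')
      ((tensorRep (pathRep (freeTree α)) (pathRep (freeTree α))).comp (leftMul α) g t) =
    (1 : FreeGroup α →* (ℝ ≃ₗᵢ[ℝ] ℝ)) g (tensorForm (lambda w) (lambda w') t) :=
  tensorForm_invariant _ _ _ _ _ (lambda_invariant w g) (lambda_invariant w' g) t

variable [DecidableEq α]

/-- The number of occurrences (with overlaps allowed) of `w` as a sub-word of `l`: the number of
final segments of `l` that start with `w`. -/
def occ (w l : List (α × Bool)) : ℕ := l.tails.countP fun t => w <+: t

/-- The Brooks quasimorphism `f_w`. -/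
def brooks (w : List (α × Bool)) (g : FreeGroup α) : ℝ := occ w g.toWord - occ w g⁻¹.toWord

/-- The homogeneous cocycle `(g₀, g₁, g₂) ↦ f_w(g₁⁻¹ g₂) - f_w(g₀⁻¹ g₂) + f_w(g₀⁻¹ g₁)`, the
coboundary of `(g₀, g₁) ↦ f_w(g₀⁻¹ g₁)`. -/
def brooksCocycle (w : List (α × Bool)) : (Fin 3 → FreeGroup α) → ℝ :=
  cobd fun x : Fin 2 → FreeGroup α => brooks w ((x 0)⁻¹ * x 1)

theorem occ_append (w u v : List (α × Bool)) :
    |(occ w (u ++ v) : ℝ) - occ w u - occ w v| ≤ w.length + 1 := by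
  have hcons : ∀ (s : α × Bool) (l : List (α × Bool)),
      (occ w (s :: l) : ℝ) = occ w l + if w <+: s :: l then 1 else 0 := by
    intro s l
    simp only [occ, List.tails_cons, List.countP_cons]
    push_cast
    simp
  suffices h : |(occ w (u ++ v) : ℝ) - occ w u - occ w v| ≤ min u.length w.length + 1 by
    refine h.trans ?_
    gcongr
    exact_mod_cast min_le_right _ _
  induction u with
  | nil =>
    have : (occ w [] : ℝ) ≤ 1 := by
      have h : occ w [] ≤ 1 := List.countP_le_length (l := [[]])
      exact_mod_cast h
    have h0 : (0 : ℝ) ≤ occ w [] := by positivity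
    simp only [List.nil_append, List.length_nil]
    rw [abs_le]
    simp only [Nat.cast_zero, zero_add, Nat.zero_le, min_eq_left]
    constructor <;> linarith
  | cons s u ih =>
    rw [List.cons_append, hcons, hcons]
    by_cases hlen : w.length ≤ u.length + 1
    · have : (w <+: s :: (u ++ v)) ↔ w <+: s :: u := by
        rw [← List.cons_append]
        constructor
        · intro h
          exact List.prefix_of_prefix_length_le h (List.prefix_append _ _) (by simpa using hlen)
        · intro h
          exact h.trans (List.prefix_append _ _)
      simp only [this]
      have e : ∀ a b c d : ℝ, a + d - (b + d) - c = a - b - c := by intros; ring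
      rw [e]
      refine ih.trans ?_
      gcongr
      simp
    · have h1 : min u.length w.length = u.length := min_eq_left (by omega)
      have h2 : min (s :: u).length w.length = u.length + 1 :=
        min_eq_left (by rw [List.length_cons]; omega)
      rw [h1] at ih
      rw [h2]
      push_cast
      rw [abs_le] at ih ⊢
      constructor <;> split_ifs <;> linarith

/-- `f_w` as a function of words. -/
def brooksWord (w l : List (α × Bool)) : ℝ := occ w l - occ w (FreeGroup.invRev l)

theorem brooks_eq (w : List (α × Bool)) (g : FreeGroup α) : brooks w g = brooksWord w g.toWord := by
  rw [brooks, brooksWord, FreeGroup.toWord_inv]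

theorem invRev_append (u v : List (α × Bool)) :
    FreeGroup.invRev (u ++ v) = FreeGroup.invRev v ++ FreeGroup.invRev u := by
  simp [FreeGroup.invRev]

theorem brooksWord_append (w u v : List (α × Bool)) :
    |brooksWord w (u ++ v) - brooksWord w u - brooksWord w v| ≤ 2 * (w.length + 1) := by
  have h1 := occ_append w u v
  have h2 := occ_append w (FreeGroup.invRev v) (FreeGroup.invRev u)
  rw [← invRev_append] at h2
  simp only [brooksWord]
  rw [abs_le] at h1 h2 ⊢
  constructor <;> linarith

theorem brooksWord_invRev (w u : List (α × Bool)) :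
    brooksWord w (FreeGroup.invRev u) = -brooksWord w u := by
  simp [brooksWord, FreeGroup.invRev_invRev]

theorem exists_cancel (u : List (α × Bool)) : FreeGroup.IsReduced u → ∀ v : List (α × Bool),
    FreeGroup.IsReduced v → ∃ a b c : List (α × Bool), u = a ++ FreeGroup.invRev b ∧ v = b ++ c ∧
      FreeGroup.IsReduced (a ++ c) := by
  induction u using List.reverseRecOn with
  | nil => intro _ v hv; exact ⟨[], [], v, rfl, rfl, hv⟩
  | append_singleton u s ih =>
    intro hu v hv
    cases v with
    | nil => exact ⟨u ++ [s], [], [], by simp [FreeGroup.invRev], rfl, by simpa using hu⟩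
    | cons t v =>
      by_cases hst : s.1 = t.1 → s.2 = t.2
      · refine ⟨u ++ [s], [], t :: v, by simp [FreeGroup.invRev], rfl, ?_⟩
        have : FreeGroup.IsReduced ([s] ++ t :: v) := by
          simpa [FreeGroup.isReduced_cons_cons] using ⟨hst, hv⟩
        exact hu.append_overlap this (by simp)
      · obtain ⟨a, b, c, h1, h2, h3⟩ := ih (hu.infix ⟨[], [s], by simp⟩) v
          (hv.infix ⟨[t], [], by simp⟩)
        refine ⟨a, t :: b, c, ?_, by rw [h2]; rfl, h3⟩
        have hs : s = (t.1, !t.2) := by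
          obtain ⟨s1, s2⟩ := s
          obtain ⟨t1, t2⟩ := t
          simp only [Classical.not_imp] at hst
          ext
          · exact hst.1
          · have := hst.2
            cases s2 <;> cases t2 <;> simp_all
        rw [h1, hs]
        simp [FreeGroup.invRev]

theorem brooksCocycle_apply (w : List (α × Bool)) (x : Fin 3 → FreeGroup α) :
    brooksCocycle w x = brooks w ((x 1)⁻¹ * x 2) - brooks w ((x 0)⁻¹ * x 2) +
      brooks w ((x 0)⁻¹ * x 1) := by
  have e : brooksCocycle w x = ∑ i : Fin 3, (-1 : ℤ) ^ (i : ℕ) •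
    brooks w ((x (i.succAbove 0))⁻¹ * x (i.succAbove 1)) := rfl
  have a1 : (0 : Fin 3).succAbove (0 : Fin 2) = 1 := rfl
  have a2 : (0 : Fin 3).succAbove (1 : Fin 2) = 2 := rfl
  have a3 : (1 : Fin 3).succAbove (0 : Fin 2) = 0 := rfl
  have a4 : (1 : Fin 3).succAbove (1 : Fin 2) = 2 := rfl
  have a5 : (2 : Fin 3).succAbove (0 : Fin 2) = 0 := rfl
  have a6 : (2 : Fin 3).succAbove (1 : Fin 2) = 1 := rfl
  rw [e, Fin.sum_univ_three, a1, a2, a3, a4, a5, a6]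
  simp [sub_eq_add_neg]

theorem abs_brooksCocycle_le (w : List (α × Bool)) (x : Fin 3 → FreeGroup α) :
    |brooksCocycle w x| ≤ 6 * (w.length + 1) := by
  obtain ⟨a, b, c, h1, h2, h3⟩ := exists_cancel ((x 0)⁻¹ * x 1).toWord FreeGroup.isReduced_toWord
    ((x 1)⁻¹ * x 2).toWord FreeGroup.isReduced_toWord
  have h4 : ((x 0)⁻¹ * x 2).toWord = a ++ c := by
    have e : (x 0)⁻¹ * x 2 = ((x 0)⁻¹ * x 1) * ((x 1)⁻¹ * x 2) := by group
    have e2 : (x 0)⁻¹ * x 2 = FreeGroup.mk (a ++ c) := by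
      rw [e, ← FreeGroup.mk_toWord (x := (x 0)⁻¹ * x 1), ← FreeGroup.mk_toWord (x := (x 1)⁻¹ * x 2),
        h1, h2, ← FreeGroup.mul_mk, ← FreeGroup.mul_mk, ← FreeGroup.mul_mk, ← FreeGroup.inv_mk]
      group
    rw [e2, FreeGroup.toWord_mk, h3.reduce_eq]
  have n1 := brooksWord_append w a (FreeGroup.invRev b)
  have n2 := brooksWord_append w b c
  have n3 := brooksWord_append w a c
  rw [brooksWord_invRev] at n1
  rw [brooksCocycle_apply, brooks_eq, brooks_eq, brooks_eq, h1, h2, h4]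
  rw [abs_le] at n1 n2 n3 ⊢
  constructor <;> linarith

theorem brooksCocycle_mem (w : List (α × Bool)) :
    brooksCocycle w ∈ cocycles (1 : FreeGroup α →* (ℝ ≃ₗᵢ[ℝ] ℝ)) 2 := by
  refine ⟨⟨continuous_of_discreteTopology, ⟨_, abs_brooksCocycle_le w⟩, fun g x => ?_⟩,
    cobd_cobd _⟩
  change brooksCocycle w (fun i => g * x i) = brooksCocycle w x
  simp only [brooksCocycle_apply, mul_inv_rev, mul_assoc, inv_mul_cancel_left]

/-- The class `β_w ∈ H_b²(F, ℝ)` of the Brooks quasimorphism `f_w`. -/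
def brooksClass (w : List (α × Bool)) : Hcb (1 : FreeGroup α →* (ℝ ≃ₗᵢ[ℝ] ℝ)) 2 :=
  cls (brooksCocycle w) (brooksCocycle_mem w)

end FreeGroups

end BCoh

end

noncomputable section

open scoped TensorProduct

namespace BCoh

open UniformSpace

/-! ### Restriction and change of coefficients on cocycles -/

section Classes

variable {G E K F : Type*} [Group G] [TopologicalSpace G] [NormedAddCommGroup E] [NormedSpace ℝ E]
  [Group K] [TopologicalSpace K] [NormedAddCommGroup F] [NormedSpace ℝ F]
  {ρ : G →* (E ≃ₗᵢ[ℝ] E)} {σ : K →* (F ≃ₗᵢ[ℝ] F)}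

/-! Cup product, restriction and change of coefficients are all given by formulas on cocycles, so
the image of `[ω] ∪ [ω]` is represented by `(λ_w ⊗ λ_{w'})(ω(g₀v, g₁v, g₂v) ⊗ ω(g₂v, g₃v, g₄v))`. By
definition of the tensor product of two forms this is the product `λ_w(ω(g₀v, g₁v, g₂v)) ·
λ_{w'}(ω(g₂v, g₃v, g₄v))`. Everything therefore reduces to the degree two cocycles `λ_w ∘ ω`.

The key fact is `lambda₀_theta`: `λ_w(θ(x₀, x₁)) = f_w(x₀⁻¹x₁)`. The edges of `[x₀, x₁]` spell the
reduced word of `x₀⁻¹x₁` (`geod_map_label`), so its sub-paths labelled by `w` correspond to the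
occurrences of `w` in that word (`ncard_infix_labelled`, `ncard_paths_labelled`). Reversing the
geodesic gives in the same way the occurrences in the inverse, and the antisymmetry of `θ` and `λ_w`
makes the two counts appear with opposite signs. Since `λ_w` is linear and `ω = dθ`, it sends `ω` to
the Brooks cocycle evaluated at the translated points `gᵢv` (`lambda_omegaCochain`).

It remains to remove `v`. The translated cocycle is the coboundary of `f_w(v⁻¹ g₀⁻¹g₁ v)`, which in
general is an unbounded cochain, just like `f_w(g₀⁻¹g₁)`. Their difference, however, is bounded
because `f_w` is a quasimorphism, and it is invariant. So both cocycles represent `β_w`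
(`cls_brooksCocycle_translate`), and with the translated representatives the required identity holds
already between cocycles. -/

theorem cls_congr {n : ℕ} {f f' : (Fin (n + 1) → G) → E} {hf : f ∈ cocycles ρ n}
    {hf' : f' ∈ cocycles ρ n} (h : f = f') : cls f hf = cls f' hf' := by
  subst h
  rfl

theorem mapFun_mem_cocycles (φ : K →* G) (hφ : Continuous φ) (A : E →L[ℝ] F)
    (hA : ∀ k v, A (ρ (φ k) v) = σ k (A v)) (n : ℕ) {f : (Fin (n + 1) → G) → E}
    (hf : f ∈ cocycles ρ n) : mapFun φ A n f ∈ cocycles σ n := by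
  have h0 : cobd f = 0 := hf.2
  refine ⟨mapFun_mem_cochains φ hφ A hA n hf.1, ?_⟩
  change cobd (mapFun φ A n f) = 0
  rw [cobd_mapFun, h0, map_zero]

/-- Restriction is precomposition with `φ` and `A_*` is postcomposition with `A`, both applied to a
representative. The two steps compose definitionally to `mapFun φ A n`, which allows all later
computations to be made on cocycles. -/
theorem coeff_res_cls (φ : K →* G) (hφ : Continuous φ) (A : E →L[ℝ] F)
    (hA : ∀ k v, A ((ρ.comp φ) k v) = σ k (A v)) (n : ℕ) (f : (Fin (n + 1) → G) → E)
    (hf : f ∈ cocycles ρ n) :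
    coeff A hA n (res ρ φ hφ n (cls f hf)) =
      cls (mapFun φ A n f) (mapFun_mem_cocycles φ hφ A hA n hf) :=
  rfl

end Classes

/-! ### Occurrences of a word and labelled segments -/

section Labelling

variable {α : Type*}

/-- The nested case distinction in `lambdaVal` is a difference of two indicators because no word
labels both a path and its reverse (`not_labels_rev`). In this form it is antisymmetrised in the
same way as the values of `θ`. -/
theorem lambdaVal_eq_sub (w : List (α × Bool)) (p : TPath (freeTree α))
    [Decidable (Labels w p)] [Decidable (Labels w p.rev)] :
    lambdaVal w p = (if Labels w p then 1 else 0) - (if Labels w p.rev then 1 else 0) := by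
  unfold lambdaVal
  by_cases h : Labels w p
  · simp [h, not_labels_rev h]
  · by_cases h' : Labels w p.rev <;> simp [h, h']

theorem map_letter_prefix {w L : List (α × Bool)} :
    w.map letter <+: L.map letter ↔ w <+: L := by
  refine ⟨fun h => ?_, fun h => h.map _⟩
  obtain ⟨t, htL, ht⟩ := List.prefix_map_iff.1 h
  rwa [letter_injective.list_map ht]

/-- The sub-sequences of consecutive edges of `q` labelled by the non-empty word `w` correspond to
the occurrences of `w` in the word labelling `q`. -/
theorem ncard_infix_labelled [DecidableEq α] {w : List (α × Bool)} (hw : w ≠ [])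
    (q : List (freeTree α).Dart) : ∀ (L : List (α × Bool)), q.Nodup →
    q.map (fun e => e.fst⁻¹ * e.snd) = L.map letter →
    {l | l <:+: q ∧ l.map (fun e => e.fst⁻¹ * e.snd) = w.map letter}.ncard = occ w L := by
  induction q with
  | nil =>
    intro L _ hL
    obtain rfl : L = [] := by simpa using hL.symm
    have h : {l : List (freeTree α).Dart |
        l <:+: [] ∧ l.map (fun e => e.fst⁻¹ * e.snd) = w.map letter} = ∅ := by
      -- The only segment of the empty sequence is empty, and `w` does not label it. Here `w ≠ []`
      -- matters: the empty word has one occurrence in the empty word.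
      refine Set.eq_empty_iff_forall_notMem.2 fun l hl => hw ?_
      obtain rfl := List.infix_nil.1 hl.1
      simpa using hl.2.symm
    rw [h, Set.ncard_empty]
    simp [occ, hw]
  | cons e q ih =>
    intro L hq hL
    obtain ⟨s, L, rfl⟩ : ∃ s L', L = s :: L' := by
      cases L with
      | nil => simp at hL
      | cons s L => exact ⟨s, L, rfl⟩
    have hL' : q.map (fun e => e.fst⁻¹ * e.snd) = L.map letter := by
      simp only [List.map_cons, List.cons.injEq] at hL
      exact hL.2
    rw [List.nodup_cons] at hq
    have hfin : {l | l <:+: q ∧ l.map (fun e => e.fst⁻¹ * e.snd) = w.map letter}.Finite :=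
      (q.sublists.finite_toSet).subset fun l hl => List.mem_sublists.2 hl.1.sublist
    -- Adding a first letter creates one new tail, hence at most one new occurrence, the initial
    -- one. On the other side a segment of `e :: q` is either initial or a segment of `q`.
    have hocc : occ w (s :: L) = occ w L + if w <+: s :: L then 1 else 0 := by
      simp [occ, List.countP_cons]
    rw [hocc, ← ih L hq.2 hL']
    by_cases hp : w <+: s :: L
    · obtain ⟨l, hl, hlw⟩ := List.prefix_map_iff.1 (hL ▸ hp.map letter)
      have hne : l ≠ [] := by
        rintro rfl
        exact hw (by simpa using hlw)
      have hins : {l | l <:+: e :: q ∧ l.map (fun e => e.fst⁻¹ * e.snd) = w.map letter} =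
          insert l {l | l <:+: q ∧ l.map (fun e => e.fst⁻¹ * e.snd) = w.map letter} := by
        ext l'
        simp only [Set.mem_insert_iff, Set.mem_ofPred_eq, List.infix_cons_iff]
        constructor
        · rintro ⟨h | h, h'⟩
          · left
            -- The label determines the length, and there is only one initial segment of a given
            -- length.
            have hlen : l'.length = l.length := by
              have := congrArg List.length (h'.trans hlw)
              simpa using this
            exact (List.prefix_of_prefix_length_le h hl hlen.le).eq_of_length hlen
          · exact Or.inr ⟨h, h'⟩
        · rintro (rfl | h)
          · exact ⟨Or.inl hl, hlw.symm⟩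
          · exact ⟨Or.inr h.1, h.2⟩
      rw [hins, Set.ncard_insert_of_notMem _ hfin, if_pos hp]
      -- The segments are counted as lists of edges and not by their positions, so `l` must not
      -- occur again inside `q`. It starts with `e`, which is not in `q` since the edges are
      -- distinct.
      rintro ⟨h, -⟩
      obtain ⟨f, l, rfl⟩ := List.exists_cons_of_ne_nil hne
      obtain rfl : f = e := (List.cons_prefix_cons.1 hl).1
      exact hq.1 (h.subset (by simp))
    · rw [if_neg hp, add_zero]
      congr 1
      ext l
      simp only [Set.mem_ofPred_eq, List.infix_cons_iff]
      refine ⟨fun h => ⟨h.1.resolve_left fun h' => hp ?_, h.2⟩, fun h => ⟨Or.inr h.1, h.2⟩⟩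
      rw [← map_letter_prefix, ← hL, ← h.2]
      exact h'.map _

/-! ### Geodesics of the Cayley tree and their labels -/

/-- The letters along a path form a reduced word representing `x⁻¹y` (`exists_word_of_isPath`), and
a group element has only one reduced word. -/
theorem geod_map_label [DecidableEq α] (x y : FreeGroup α) :
    (geod freeTree_isTree x y).map (fun e => e.fst⁻¹ * e.snd) =
      (x⁻¹ * y).toWord.map letter := by
  obtain ⟨p, hp, -⟩ := (freeTree_isTree (α := α)).existsUnique_path x y
  obtain ⟨L, h1, h2, h3⟩ := exists_word_of_isPath p hp
  rw [geod_eq _ p hp, h3, ← h2, FreeGroup.toWord_mk, h1.reduce_eq]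

theorem revList_geod {V : Type*} {T : SimpleGraph V} (hT : T.IsTree) (x y : V) :
    revList (geod hT x y) = geod hT y x := by
  obtain ⟨p, hp, -⟩ := hT.existsUnique_path x y
  rw [geod_eq hT p hp, geod_eq hT p.reverse hp.reverse, SimpleGraph.Walk.darts_reverse, revList]

/-- This property passes to segments, so that every non-empty segment of a geodesic is a path in the
sense of `TPath`. -/
theorem isChain_geod {V : Type*} {T : SimpleGraph V} (hT : T.IsTree) (x y : V) :
    (geod hT x y).IsChain fun e f => e.snd = f.fst ∧ f ≠ e.symm := by
  obtain ⟨p, hp, -⟩ := hT.existsUnique_path x y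
  have h := p.isChain_dartAdj_darts
  -- In an acyclic graph, being a path means that consecutive unoriented edges differ. A
  -- backtracking step would repeat the unoriented edge.
  have h' := (hT.isAcyclic.isPath_iff_isChain _).1 hp
  rw [SimpleGraph.Walk.edges, List.isChain_map] at h'
  rw [geod_eq hT p hp]
  rw [List.isChain_iff_getElem] at *
  refine fun i hi => ⟨h i hi, fun e => h' i hi ?_⟩
  rw [e, SimpleGraph.Dart.edge_symm]

/-- The count of `ncard_infix_labelled` carries over from lists of edges to `TPath`: a segment of
the geodesic labelled by a non-empty word is itself non-empty, hence a path, and a path is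
determined by its edges. -/
theorem ncard_paths_labelled [DecidableEq α] {w : List (α × Bool)} (hw : w ≠ [])
    (x y : FreeGroup α) :
    {p : TPath (freeTree α) | p.edges <:+: geod freeTree_isTree x y ∧ Labels w p}.ncard =
      occ w (x⁻¹ * y).toWord := by
  rw [← ncard_infix_labelled hw _ _ (geod_nodup _ x y) (geod_map_label x y),
    ← Set.ncard_image_of_injective _ (f := TPath.edges) fun p p' h => TPath.ext h]
  congr 1
  ext l
  constructor
  · rintro ⟨p, hp, rfl⟩
    exact hp
  · intro hl
    refine ⟨⟨l, ?_, (isChain_geod _ x y).infix hl.1⟩, hl, rfl⟩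
    rintro rfl
    exact hw (by simpa using hl.2.symm)

/-! ### The values of `λ_w` on geodesics -/

theorem occ_nil [DecidableEq α] (L : List (α × Bool)) : occ [] L = L.length + 1 := by
  simp [occ]

/-- The number of occurrences of the empty word depends only on the length, and `g` and `g⁻¹` have
the same length. -/
theorem brooks_nil [DecidableEq α] (g : FreeGroup α) : brooks [] g = 0 := by
  rw [brooks, occ_nil, occ_nil, ← FreeGroup.norm, ← FreeGroup.norm, FreeGroup.norm_inv_eq, sub_self]

theorem lambdaVal_nil (p : TPath (freeTree α)) : lambdaVal [] p = 0 := by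
  have h : ∀ p : TPath (freeTree α), ¬ Labels [] p := fun p hp =>
    p.isTPath.1 (by simpa [Labels] using hp)
  simp [lambdaVal, h]

/-- On the paths between vertices, the linear form `λ_w` is the Brooks quasimorphism. -/
theorem lambda₀_theta [DecidableEq α] (w : List (α × Bool)) (x : Fin 2 → FreeGroup α) :
    lambda₀ w (theta freeTree_isTree x) = brooks w ((x 0)⁻¹ * x 1) := by
  classical
  -- The empty word is treated apart, as the counting lemmas need `w ≠ []`: paths are non-empty, so
  -- the form vanishes, and so does the quasimorphism.
  rcases eq_or_ne w [] with rfl | hw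
  · simp [brooks_nil, lambda₀_apply, lambdaVal_nil]
  set q := geod freeTree_isTree (x 0) (x 1) with hq
  have hfin : ∀ q : List (freeTree α).Dart, {p : TPath (freeTree α) | p.edges <:+: q}.Finite :=
    fun q => Set.Finite.preimage (f := TPath.edges) (fun p _ p' _ h => TPath.ext h)
      ((q.sublists.finite_toSet).subset
        fun l (hl : l <:+: q) => List.mem_sublists.2 hl.sublist)
  have hrev : ∀ p : TPath (freeTree α), p.rev.edges <:+: q ↔ p.edges <:+: revList q := by
    intro p
    rw [← revList_infix, show revList p.rev.edges = p.edges from revList_revList p.edges]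
  -- A finite set of paths that contains the support of `θ` and is stable under reversal, so that
  -- sums over it can be reindexed by `p ↦ p̄`.
  let U : Finset (TPath (freeTree α)) := (hfin q).toFinset ∪ (hfin (revList q)).toFinset
  have hU : ∀ p, p ∈ U ↔ p.edges <:+: q ∨ p.rev.edges <:+: q := by
    intro p
    simp [U, hrev]
  have hUrev : ∀ p, p.rev ∈ U ↔ p ∈ U := by
    intro p
    rw [hU, hU, TPath.rev_rev, or_comm]
  have hswap : ∀ f : TPath (freeTree α) → ℝ, ∑ p ∈ U, f p.rev = ∑ p ∈ U, f p := fun f =>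
    Finset.sum_nbij' TPath.rev TPath.rev (fun p hp => (hUrev p).2 hp) (fun p hp => (hUrev p).2 hp)
      (by simp) (by simp) (by simp)
  let A : TPath (freeTree α) → ℝ := fun p => if p.edges <:+: q then 1 else 0
  let B : TPath (freeTree α) → ℝ := fun p => if Labels w p then 1 else 0
  -- `A` is the indicator of the sub-paths of `[x₀, x₁]` and `B` that of the paths labelled by `w`.
  -- Both factors are antisymmetrised, and the `1 / 2` comes from the definition of `lambda₀`.
  have hsum : lambda₀ w (theta freeTree_isTree x) =
      1 / 2 * ∑ p ∈ U, (A p - A p.rev) * (B p - B p.rev) := by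
    rw [lambda₀_apply, Finsupp.sum_of_support_subset (s := U) _ ?_ _ (by simp)]
    · refine congrArg _ (Finset.sum_congr rfl fun p _ => ?_)
      have h : (theta freeTree_isTree x).1 p = A p - A p.rev := by
        refine (subpathSum_apply _ p).trans ?_
        simp only [A, hq]
        congr
      rw [lambdaVal_eq_sub, h]
    · intro p hp
      by_contra hc
      rw [hU, not_or] at hc
      refine Finsupp.mem_support_iff.1 hp ((subpathSum_apply _ p).trans ?_)
      rw [← hq]
      simp [hc.1, hc.2]
  have h1 : ∑ p ∈ U, A p * B p = occ w ((x 0)⁻¹ * x 1).toWord := by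
    rw [← ncard_paths_labelled hw, ← hq]
    have e : {p : TPath (freeTree α) | p.edges <:+: q ∧ Labels w p} =
        (U.filter fun p => p.edges <:+: q ∧ Labels w p : Finset _) := by
      ext p
      simp only [Set.mem_ofPred_eq, Finset.coe_filter, hU]
      tauto
    rw [e, Set.ncard_coe_finset, Finset.card_filter, Nat.cast_sum]
    exact Finset.sum_congr rfl fun p _ => by
      simp only [A, B]; split_ifs <;> simp_all
  have h2 : ∑ p ∈ U, A p.rev * B p = occ w ((x 0)⁻¹ * x 1)⁻¹.toWord := by
    -- The reverse of `p` lies on `[x₀, x₁]` exactly when `p` lies on `[x₁, x₀]`, whose label is the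
    -- word of the inverse.
    rw [show ((x 0)⁻¹ * x 1)⁻¹ = (x 1)⁻¹ * x 0 by group, ← ncard_paths_labelled hw,
      ← revList_geod, ← hq]
    have e : {p : TPath (freeTree α) | p.edges <:+: revList q ∧ Labels w p} =
        (U.filter fun p => p.rev.edges <:+: q ∧ Labels w p : Finset _) := by
      ext p
      simp only [Set.mem_ofPred_eq, Finset.coe_filter, hU, hrev]
      tauto
    rw [e, Set.ncard_coe_finset, Finset.card_filter, Nat.cast_sum]
    exact Finset.sum_congr rfl fun p _ => by
      simp only [A, B]; split_ifs <;> simp_all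
  have h3 := hswap fun p => A p * B p
  have h4 := hswap fun p => A p.rev * B p
  simp only [TPath.rev_rev] at h4
  have hexp : ∑ p ∈ U, (A p - A p.rev) * (B p - B p.rev) =
      ∑ p ∈ U, A p * B p - ∑ p ∈ U, A p * B p.rev - ∑ p ∈ U, A p.rev * B p +
        ∑ p ∈ U, A p.rev * B p.rev := by
    rw [← Finset.sum_sub_distrib, ← Finset.sum_sub_distrib, ← Finset.sum_add_distrib]
    exact Finset.sum_congr rfl fun p _ => by ring
  -- Reversal identifies the four sums in pairs, and the resulting factor 2 cancels the `1 / 2`.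
  rw [hsum, hexp, h3, h4, h1, h2, brooks]
  ring

end Labelling

/-! ### From `ω` to the Brooks class: changing the base point -/

section Restriction

variable {α : Type*} [DecidableEq α]

/-- A linear form commutes with the coboundary, so this is `lambda₀_theta` applied to each face of
the triangle with vertices `gᵢv`. -/
theorem lambda_omegaCochain (w : List (α × Bool)) (v : FreeGroup α) (g : Fin 3 → FreeGroup α) :
    lambda w (omegaCochain freeTree_isTree v fun i => leftMul α (g i)) =
      brooksCocycle w fun i => g i * v := by
  rw [lambda, omegaCochain, ContinuousLinearMap.fromCompletion_apply_coe, omega, brooksCocycle]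
  simp only [cobd, map_sum, map_zsmul, lambda₀_theta]
  rfl

/-- The quasimorphism inequality is the bound on the Brooks cocycle, read at the triple `(1, g,
gh)`. -/
theorem abs_brooks_mul_le (w : List (α × Bool)) (g h : FreeGroup α) :
    |brooks w h - brooks w (g * h) + brooks w g| ≤ 6 * (w.length + 1) := by
  simpa [brooksCocycle_apply] using abs_brooksCocycle_le w ![1, g, g * h]

/-- Right translation by `v` commutes with the diagonal left action and with the omission of
variables, and it does not affect boundedness. -/
theorem brooksCocycle_translate_mem (w : List (α × Bool)) (v : FreeGroup α) :
    (fun g => brooksCocycle w fun i => g i * v) ∈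
      cocycles (1 : FreeGroup α →* (ℝ ≃ₗᵢ[ℝ] ℝ)) 2 := by
  have h := brooksCocycle_mem w
  obtain ⟨⟨-, ⟨C, hC⟩, he⟩, hz⟩ := h
  refine ⟨⟨continuous_of_discreteTopology, ⟨C, fun g => hC _⟩, fun g x => ?_⟩, ?_⟩
  · have := he g fun i => x i * v
    simpa only [mul_assoc] using this
  · funext x
    exact congrFun hz fun i => x i * v

/-- The class of the Brooks cocycle does not depend on the base point. -/
theorem cls_brooksCocycle_translate (w : List (α × Bool)) (v : FreeGroup α) :
    cls (fun g => brooksCocycle w fun i => g i * v) (brooksCocycle_translate_mem w v) =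
      brooksClass w := by
  refine (Submodule.Quotient.eq _).2 ?_
  -- With `h = x₀⁻¹x₁` the primitive is `f_w(v⁻¹hv) - f_w(h)`. The quasimorphism inequality is used
  -- twice, to split off `v⁻¹` on the left and `v` on the right. This costs two defects `6 (|w| +
  -- 1)` and the values of `f_w` at `v` and `v⁻¹`.
  refine ⟨fun x => brooks w ((x 0 * v)⁻¹ * (x 1 * v)) - brooks w ((x 0)⁻¹ * x 1),
    ⟨continuous_of_discreteTopology,
      ⟨12 * (w.length + 1) + |brooks w v| + |brooks w v⁻¹|, fun x => ?_⟩, fun g x => ?_⟩, ?_⟩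
  · have h1 := abs_brooks_mul_le w v⁻¹ ((x 0)⁻¹ * x 1 * v)
    have h2 := abs_brooks_mul_le w ((x 0)⁻¹ * x 1) v
    have h3 := abs_le.1 (le_refl |brooks w v|)
    have h4 := abs_le.1 (le_refl |brooks w v⁻¹|)
    change |brooks w ((x 0 * v)⁻¹ * (x 1 * v)) - brooks w ((x 0)⁻¹ * x 1)| ≤ _
    rw [show (x 0 * v)⁻¹ * (x 1 * v) = v⁻¹ * ((x 0)⁻¹ * x 1 * v) by group]
    rw [abs_le] at h1 h2 ⊢
    constructor <;> linarith
  · change brooks w ((g * x 0 * v)⁻¹ * (g * x 1 * v)) - brooks w ((g * x 0)⁻¹ * (g * x 1)) =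
      brooks w ((x 0 * v)⁻¹ * (x 1 * v)) - brooks w ((x 0)⁻¹ * x 1)
    congr 2 <;> group
  -- The coboundaries of the two terms are by definition the translated and the original Brooks
  -- cocycle.
  · exact (cobdL _ ℝ 1).map_sub (fun x => brooks w ((x 0 * v)⁻¹ * (x 1 * v)))
      fun x => brooks w ((x 0)⁻¹ * x 1)

end Restriction

end BCoh

end

/-! ### The image of the cup product -/

theorem mainTheorem6 {α : Type*} [Finite α] [DecidableEq α] (w w' : List (α × Bool))
    (hw : FreeGroup.IsReduced w) (hw' : FreeGroup.IsReduced w') (v : FreeGroup α) :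
    BCoh.coeff (σ := (1 : FreeGroup α →* (ℝ ≃ₗᵢ[ℝ] ℝ)))
        (BCoh.tensorForm (BCoh.lambda w) (BCoh.lambda w')) (BCoh.lambdaTensor_equivariant w w')
        (2 + 2)
        (BCoh.res (BCoh.tensorRep (BCoh.pathRep (BCoh.freeTree α))
            (BCoh.pathRep (BCoh.freeTree α))) (BCoh.leftMul α) BCoh.continuous_leftMul (2 + 2)
          (BCoh.cup (BCoh.tensorMk _ _)
            (BCoh.tensorMk_equivariant (BCoh.pathRep (BCoh.freeTree α))
              (BCoh.pathRep (BCoh.freeTree α))) 2 2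
            (BCoh.omegaClass BCoh.freeTree_isTree v) (BCoh.omegaClass BCoh.freeTree_isTree v))) =
      BCoh.cup (ContinuousLinearMap.mul ℝ ℝ) (fun _ _ _ => rfl) 2 2
        (BCoh.brooksClass w) (BCoh.brooksClass w') := by
  -- With the Brooks classes represented by the cocycles translated by `v`, the two sides agree as
  -- cocycles, and no primitive in degree 3 is needed.
  rw [← BCoh.cls_brooksCocycle_translate w v, ← BCoh.cls_brooksCocycle_translate w' v,
    BCoh.omegaClass]
  refine (BCoh.coeff_res_cls _ _ _ _ _ _ _).trans (BCoh.cls_congr (funext fun g => ?_))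
  -- The cup product cocycle takes elementary tensors as values, so the form splits into a product
  -- of two values.
  refine (BCoh.tensorForm_tensorMk (BCoh.lambda w) (BCoh.lambda w') _ _).trans ?_
  exact congrArg₂ (· * ·) (BCoh.lambda_omegaCochain w v _) (BCoh.lambda_omegaCochain w' v _)
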